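/- Let $\mathbb S^1=\mathbb R/\mathbb Z$ and $\mathbb T^2=\mathbb S^1\times\mathbb S^1$, with normalized Lebesgue measures. Let $(\Omega,\mathcal F,\mathbb P)$ be a probability space and $\theta:\Omega\to\Omega$ an ergodic $\mathbb P$-preserving bi-measurable bijection. Let $k\ge 2$ be an integer and let $f_0:\mathbb T^2\to\mathbb T^2$, $$f_0(x,s)=\big(kg_0(x)\ \mathrm{mod}\ 1,\ s+\tfrac1{2\pi}\tau_0(x)\ \mathrm{mod}\ 1\big),$$ where $g_0$ is a $C^\infty$ diffeomorphism of $\mathbb S^1$, $\tau_0:\mathbb S^1\to\mathbb R$ is $C^\infty$, and $E_0(x)=kg_0(x)\ \mathrm{mod}\ 1$ satisfies $\lambda_0:=\min_xE_0'(x)>1$. Put $\lambda=(\lambda_0+1)/2$. For $\epsilon>0$ let $f_\epsilon:\Omega\to C^\infty(\mathbb T^2,\mathbb T^2)$ be such that $\omega\mapsto f_\epsilon(\omega)(z)$ is measurable for every $z\in\mathbb T^2$ and, for $\mathbb P$-almost every $\omega$, $$f_\epsilon(\omega)(x,s)=\big(kg_\epsilon(\omega,x)\ \mathrm{mod}\ 1,\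 s+\tfrac1{2\pi}\tau_\epsilon(\omega,x)\ \mathrm{mod}\ 1\big)$$ with $g_\epsilon(\omega,\cdot)$ a $C^\infty$ diffeomorphism of $\mathbb S^1$ and $\tau_\epsilon(\omega,\cdot):\mathbb S^1\to\mathbb R$ of class $C^\infty$. Assume that $$\operatorname*{ess\,sup}_\omega d_{C^\infty}(f_\epsilon(\omega),f_0)\to0\quad\text{as }\epsilon\to0,\qquad d_{C^\infty}=\sum_{j\ge0}2^{-j}\frac{d_{C^j}}{1+d_{C^j}},$$ where $d_{C^j}$ is the usual $C^j$ distance. For $\epsilon=0$ read $f_0$ as the constant map $\omega\mapsto f_0$. Let $E_\epsilon(\omega)(x)=kg_\epsilon(\omega,x)\ \mathrm{mod}\ 1$, $E_\epsilon^{(n)}(\omega)=E_\epsilon(\theta^{n-1}\omega)\circ\cdots\circ E_\epsilon(\omega)$, and $$M^*_{0,n}(\epsilon;\omega)\varphi(x)=\sum_{E^{(n)}_\epsilon(\omega)(y)=x}\frac{\varphi(y)}{dE^{(n)}_\epsilon(\omega)(y)/dy}.$$ A measure $\mu$ on $\Omega\times\mathbb T^2$ is $f_\epsilon$-invariant if it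 is invariant under $(\omega,z)\mapsto(\theta\omega,f_\epsilon(\omega)(z))$ and has marginal $\mathbb P$ on $\Omega$. Let $\|u\|_{(m)}^2=\sum_{\xi\in2\pi\mathbb Z}(1+|\xi|^2)^m|\hat u(\xi)|^2$ be the Sobolev norm of $H^m(\mathbb S^1)$. **Theorem.** There is an $\epsilon_0>0$ such that $$(1)\qquad \operatorname*{ess\,inf}_\omega\min_x\frac{dE_\epsilon(\omega)(x)}{dx}\ge\lambda\quad\text{for all }0\le\epsilon<\epsilon_0.$$ Let $\epsilon_0>0$ be any number satisfying (1) for which, in addition, $$(2)\qquad \operatorname*{ess\,sup}_\omega d_{C^j}(f_\epsilon(\omega),f_0)<\infty\quad\text{for all }0<\epsilon<\epsilon_0\text{ and all }j\in\mathbb N.$$ Then for each $0\le\epsilon<\epsilon_0$ there is an $f_\epsilon$-invariant probability measure $\mu^\epsilon$ on $\Omega\times\mathbb T^2$ whose disintegration $\mu^\epsilon_\omega$ with respect to $\mathbb P$ is $\mathbb P$-almost surely equivalent to Lebesgue measure on $\mathbb T^2$, with $d\mu^\epsilon_\omega=h_\epsilon(\omega,x)\,dx\,ds$. Here $h_\epsilon$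 is the unique (up to $\mathbb P$-null sets of $\omega$) function, measurable in $(\omega,x)$, such that for $\mathbb P$-almost every $\omega$: $h_\epsilon(\omega)=h_\epsilon(\omega,\cdot)$ is positive and in $C^\infty(\mathbb S^1)$, $\int_{\mathbb S^1}h_\epsilon(\omega,x)\,dx=1$, and $M^*_{0,n}(\epsilon;\omega)h_\epsilon(\omega)=h_\epsilon(\theta^n\omega)$ for all $n\ge1$. Moreover, $h_0(\omega)=h_0$ is almost surely independent of $\omega$, and for every $m\in\mathbb N$ $$\operatorname*{ess\,sup}_\omega\|h_\epsilon(\omega)-h_0\|_{(m)}\to0\quad\text{as }\epsilon\to0.$$ -/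

import Mathlib

open MeasureTheory ProbabilityTheory Filter Topology
open scoped ENNReal

noncomputable section

namespace RandomExpanding

/-- The circle `ℝ / ℤ`, with its normalized Lebesgue measure `volume`. -/
abbrev S1 : Type := UnitAddCircle

/-- The torus `ℝ² / ℤ²`, with its normalized Lebesgue measure `volume`. -/
abbrev T2 : Type := S1 × S1

/-- The covering map `ℝ² → T²`. -/
def torusProj (p : ℝ × ℝ) : T2 := ((p.1 : S1), (p.2 : S1))

/-- A smooth endomorphism of the torus: a map that lifts to a `C^∞` map of the universal cover. -/
structure SmoothTorusMap where
  toFun : T2 → T2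
  exists_lift : ∃ F : ℝ × ℝ → ℝ × ℝ, ContDiff ℝ (⊤ : ℕ∞) F ∧ ∀ p, toFun (torusProj p) = torusProj (F p)

instance : CoeFun SmoothTorusMap (fun _ => T2 → T2) := ⟨SmoothTorusMap.toFun⟩

/-- A lift of `f` to `ℝ²`. Two lifts differ by a constant vector of `ℤ²`, so derivatives of
positive order do not depend on the choice; they are `ℤ²`-periodic, hence bounded. -/
def SmoothTorusMap.lift (f : SmoothTorusMap) : ℝ × ℝ → ℝ × ℝ := f.exists_lift.choose

/-- The `C^j` distance on `C^∞(T², T²)`. -/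
def distC (j : ℕ) (f g : SmoothTorusMap) : ℝ :=
  (⨆ z : T2, dist (f z) (g z)) +
    ∑ i ∈ Finset.Icc 1 j,
      ⨆ p : ℝ × ℝ, ‖iteratedFDeriv ℝ i f.lift p - iteratedFDeriv ℝ i g.lift p‖

/-- The `C^∞` metric on `C^∞(T², T²)`. -/
def distCinf (f g : SmoothTorusMap) : ℝ :=
  ∑' j : ℕ, (2 : ℝ)⁻¹ ^ j * (distC j f g / (1 + distC j f g))

/-- A smooth map of the circle to itself. -/
def IsSmoothCircleMap (u : S1 → S1) : Prop :=
  ∃ U : ℝ → ℝ, ContDiff ℝ (⊤ : ℕ∞) U ∧ ∀ t : ℝ, u (t : S1) = (U t : S1)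

/-- A `C^∞` diffeomorphism of the circle. -/
def IsCircleDiffeo (g : S1 → S1) : Prop :=
  IsSmoothCircleMap g ∧
    ∃ g' : S1 → S1, IsSmoothCircleMap g' ∧ Function.LeftInverse g' g ∧ Function.RightInverse g' g

/-- A smooth real function on the circle. -/
def IsSmoothCircleFun (φ : S1 → ℝ) : Prop := ContDiff ℝ (⊤ : ℕ∞) (fun t : ℝ => φ (t : S1))

/-- `f` is the skew product `(x, s) ↦ (k g(x) mod 1, s + τ(x) / 2π mod 1)` for some diffeomorphism
`g` of the circle and some smooth real function `τ` on the circle. -/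
def IsSkewProductMap (k : ℕ) (f : SmoothTorusMap) : Prop :=
  ∃ (g : S1 → S1) (τ : S1 → ℝ), IsCircleDiffeo g ∧ IsSmoothCircleFun τ ∧
    ∀ x s : S1, f (x, s) = (k • g x, s + ((τ x / (2 * Real.pi) : ℝ) : S1))

/-- The circle map underlying a skew product on the torus: `x ↦ k g(x) mod 1`. -/
def baseMap (f : SmoothTorusMap) (x : S1) : S1 := (f (x, 0)).1

/-- The derivative of a circle map at `x`, as a real number: the derivative at `0` of
`t ↦ u (x + t) - u x`, the latter read in the coordinate `(-1/2, 1/2]` of the circle. -/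
def circleDeriv (u : S1 → S1) (x : S1) : ℝ :=
  deriv (fun t : ℝ => ((AddCircle.equivIoc (1 : ℝ) (-1 / 2)) (u (x + (t : S1)) - u x) : ℝ)) 0

/-- The Perron-Frobenius transfer operator of a circle map `u`. -/
def transferOp (u : S1 → S1) (φ : S1 → ℝ) (x : S1) : ℝ :=
  ∑ᶠ y ∈ {y : S1 | u y = x}, φ y / circleDeriv u y

variable {Ω : Type*}

/-- The cocycle `E^{(n)}(ω) = E(θ^{n-1} ω) ∘ ⋯ ∘ E(θ ω) ∘ E(ω)`. -/
def cocycle (θ : Ω → Ω) (E : Ω → S1 → S1) : ℕ → Ω → S1 → S1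
  | 0, _ => id
  | n + 1, ω => E (θ^[n] ω) ∘ cocycle θ E n ω

/-- The reduced transfer operator `M*_{0,n}(ω)` of the random map `f`. (The weight
`exp (-i ν τ^{(n)})` of the `ν`-th Fourier mode in the fibre direction is `1` for `ν = 0`.) -/
def reducedTransferOp (θ : Ω → Ω) (f : Ω → SmoothTorusMap) (n : ℕ) (ω : Ω) :
    (S1 → ℝ) → S1 → ℝ :=
  transferOp (cocycle θ (fun ω' => baseMap (f ω')) n ω)

/-- The skew product `Θ(ω, z) = (θ ω, f(ω, z))`. -/
def skewProduct (θ : Ω → Ω) (f : Ω → SmoothTorusMap) (q : Ω × T2) : Ω × T2 :=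
  (θ q.1, f q.1 q.2)

variable [MeasurableSpace Ω]

/-- `μ` is an `f`-invariant measure: it is invariant under the skew product, with marginal `P`. -/
def IsInvariantMeasure (P : Measure Ω) (θ : Ω → Ω) (f : Ω → SmoothTorusMap)
    (μ : Measure (Ω × T2)) : Prop :=
  MeasurePreserving (skewProduct θ f) μ μ ∧ μ.fst = P

/-- `h` is a measurable random family of smooth positive probability densities on the circle with
`M*_{0,n}(ω) h(ω) = h(θ^n ω)` for all `n ≥ 1`, almost surely. -/
structure IsEquivariantDensity (P : Measure Ω) (θ : Ω → Ω) (f : Ω → SmoothTorusMap)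
    (h : Ω → S1 → ℝ) : Prop where
  measurable : Measurable (fun q : Ω × S1 => h q.1 q.2)
  smooth : ∀ᵐ ω ∂P, IsSmoothCircleFun (h ω)
  pos : ∀ᵐ ω ∂P, ∀ x, 0 < h ω x
  integral_eq_one : ∀ᵐ ω ∂P, ∫ x, h ω x = 1
  equivariant : ∀ᵐ ω ∂P, ∀ n : ℕ, 1 ≤ n → reducedTransferOp θ f n ω (h ω) = h (θ^[n] ω)

/-- The Sobolev norm `‖u‖_{(m)} = (∑_{ξ ∈ 2πℤ} (1 + |ξ|²)^m |û(ξ)|²)^{1/2}` of a real function on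
the circle, with values in `[0, ∞]`. -/
def sobolevNorm (m : ℕ) (u : S1 → ℝ) : ℝ≥0∞ :=
  (∑' n : ℤ, ENNReal.ofReal
    ((1 + (2 * Real.pi * n) ^ 2) ^ m * ‖fourierCoeff (fun x => (u x : ℂ)) n‖ ^ 2)) ^ (1 / 2 : ℝ)

/-- `essinf_ω min_x E'(ω, x) ≥ (λ₀ + 1) / 2`, where `E(ω)` is the circle map underlying `f(ω)` and
`λ₀ = min_x E₀'(x)` for the circle map `E₀` underlying `f₀`. -/
def UniformlyExpanding (P : Measure Ω) (f₀ : SmoothTorusMap) (f : Ω → SmoothTorusMap) : Prop :=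
  ∀ᵐ ω ∂P, ∀ x, ((⨅ y, circleDeriv (baseMap f₀) y) + 1) / 2 ≤ circleDeriv (baseMap (f ω)) x

end RandomExpanding

end

/-! The density at `ω` is built from the past. With `M_i` the transfer operator of the base map at
`θ^{-i} ω`, it is the limit of `M_1 ∘ ⋯ ∘ M_n 1`, and pushing it forward by the base map at `ω`
gives the density at `θ ω`. Everything thus reduces to deterministic sequences of circle maps in a
class with expansion at least `l > 1` and bounded higher derivatives, with constants depending only
on the class.

Contraction. The positive densities with logarithmic derivative at most `a` form a cone which each
transfer operator maps into the cone of slope `σ a`, `σ < 1`. The slack lets one split off a fixed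
constant, `M φ = (1 - κ) φ' + κ` with `φ'` in the same cone (`exists_transferOp_isConeDensity`). In
a difference of two densities the constants cancel, so each step gains a factor `1 - κ`. A pointwise
Lasota-Yorke inequality (`exists_lasotaYorke`) upgrades this by induction on the order to geometric
decay of all derivatives (`exists_abs_circleD_pullback_le`), and the telescoping series defining
`pullbackDensity` converges in every `C^r`.

Uniqueness. Two equivariant families approach each other along almost every forward orbit. Their
`L¹` distance is bounded, and its integral over `Ω` is unchanged by the measure preserving `θ`, so
dominated convergence makes it zero.

Invariant measure. The density is constant along the fibres, where the skew product acts by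
rotations, so invariance of `h_ε(ω, x) dx ds` follows from the equivariance of `h_ε`.

Stability. By duality, `C⁰`-close maps have transfer operators that are close in `L¹` on the fixed
density `h₀`. Uniform loss of memory reduces the limit to a fixed finite number of steps, so the
densities are `L¹`-close to `h₀`. Interpolation with uniform derivative bounds
(`exists_sobolevNorm_le`) turns this into closeness in every Sobolev norm. -/

namespace RandomExpanding

/-! ### Calculus on the circle -/

/-- The derivative of a real function on the circle. -/
noncomputable def circleD (φ : S1 → ℝ) (x : S1) : ℝ := deriv (fun t : ℝ => φ (x + (t : S1))) 0

theorem circleD_coe (φ : S1 → ℝ) (t : ℝ) :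
    circleD φ (t : S1) = deriv (fun s : ℝ => φ (s : S1)) t := by
  have h := deriv_comp_const_add (fun s : ℝ => φ (s : S1)) t 0
  rw [add_zero] at h
  rw [← h, circleD]
  simp only [AddCircle.coe_add]

theorem circleFun_ext {α : Type*} {φ ψ : S1 → α} (h : ∀ t : ℝ, φ (t : S1) = ψ (t : S1)) :
    φ = ψ := by
  funext x
  induction x using QuotientAddGroup.induction_on with
  | H t => exact h t

theorem forall_circle {p : S1 → Prop} (h : ∀ t : ℝ, p (t : S1)) (x : S1) : p x := by
  induction x using QuotientAddGroup.induction_on with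
  | H t => exact h t

theorem continuous_circle_iff {α : Type*} [TopologicalSpace α] {φ : S1 → α} :
    Continuous φ ↔ Continuous fun t : ℝ => φ (t : S1) :=
  isQuotientMap_quotient_mk'.continuous_iff

namespace IsSmoothCircleFun

variable {φ ψ : S1 → ℝ}

theorem continuous (hφ : IsSmoothCircleFun φ) : Continuous φ :=
  continuous_circle_iff.2 (ContDiff.continuous hφ)

theorem hasDerivAt (hφ : IsSmoothCircleFun φ) (t : ℝ) :
    HasDerivAt (fun s : ℝ => φ (s : S1)) (circleD φ t) t := by
  rw [circleD_coe]
  exact ((ContDiff.differentiable hφ (by simp)) t).hasDerivAt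

theorem circleD (hφ : IsSmoothCircleFun φ) : IsSmoothCircleFun (circleD φ) := by
  have h : ContDiff ℝ (⊤ : ℕ∞) (deriv fun s : ℝ => φ (s : S1)) :=
    ((contDiff_infty_iff_deriv (𝕜 := ℝ)).1 hφ).2
  unfold IsSmoothCircleFun
  rwa [funext fun t => circleD_coe φ t]

theorem iterate_circleD (hφ : IsSmoothCircleFun φ) (n : ℕ) :
    IsSmoothCircleFun (RandomExpanding.circleD^[n] φ) := by
  induction n with
  | zero => exact hφ
  | succ n ih => rw [Function.iterate_succ_apply']; exact ih.circleD

theorem add (hφ : IsSmoothCircleFun φ) (hψ : IsSmoothCircleFun ψ) :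
    IsSmoothCircleFun (fun x => φ x + ψ x) := ContDiff.add hφ hψ

theorem sub (hφ : IsSmoothCircleFun φ) (hψ : IsSmoothCircleFun ψ) :
    IsSmoothCircleFun (fun x => φ x - ψ x) := ContDiff.sub hφ hψ

theorem mul (hφ : IsSmoothCircleFun φ) (hψ : IsSmoothCircleFun ψ) :
    IsSmoothCircleFun (fun x => φ x * ψ x) := ContDiff.mul hφ hψ

theorem const (c : ℝ) : IsSmoothCircleFun (fun _ => c) := contDiff_const

theorem inv (hφ : IsSmoothCircleFun φ) (h0 : ∀ x, φ x ≠ 0) :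
    IsSmoothCircleFun (fun x => (φ x)⁻¹) := ContDiff.inv hφ fun _ => h0 _

theorem sum {ι : Type*} {s : Finset ι} {Φ : ι → S1 → ℝ} (h : ∀ i ∈ s, IsSmoothCircleFun (Φ i)) :
    IsSmoothCircleFun (fun x => ∑ i ∈ s, Φ i x) := ContDiff.sum fun i hi => h i hi

theorem circleD_add (hφ : IsSmoothCircleFun φ) (hψ : IsSmoothCircleFun ψ) :
    RandomExpanding.circleD (fun x => φ x + ψ x) =
      fun x => RandomExpanding.circleD φ x + RandomExpanding.circleD ψ x :=
  circleFun_ext fun t => by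
    rw [circleD_coe]; exact ((hφ.hasDerivAt t).add (hψ.hasDerivAt t)).deriv

theorem circleD_sub (hφ : IsSmoothCircleFun φ) (hψ : IsSmoothCircleFun ψ) :
    RandomExpanding.circleD (fun x => φ x - ψ x) =
      fun x => RandomExpanding.circleD φ x - RandomExpanding.circleD ψ x :=
  circleFun_ext fun t => by
    rw [circleD_coe]; exact ((hφ.hasDerivAt t).sub (hψ.hasDerivAt t)).deriv

theorem circleD_mul (hφ : IsSmoothCircleFun φ) (hψ : IsSmoothCircleFun ψ) :
    RandomExpanding.circleD (fun x => φ x * ψ x) =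
      fun x => RandomExpanding.circleD φ x * ψ x + φ x * RandomExpanding.circleD ψ x :=
  circleFun_ext fun t => by
    rw [circleD_coe]; exact ((hφ.hasDerivAt t).mul (hψ.hasDerivAt t)).deriv

theorem circleD_inv (hφ : IsSmoothCircleFun φ) (h0 : ∀ x, φ x ≠ 0) :
    RandomExpanding.circleD (fun x => (φ x)⁻¹) =
      fun x => -RandomExpanding.circleD φ x / φ x ^ 2 :=
  circleFun_ext fun t => by
    rw [circleD_coe]; exact ((hφ.hasDerivAt t).inv (h0 _)).deriv

theorem circleD_sum {ι : Type*} {s : Finset ι} {Φ : ι → S1 → ℝ}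
    (h : ∀ i ∈ s, IsSmoothCircleFun (Φ i)) :
    RandomExpanding.circleD (fun x => ∑ i ∈ s, Φ i x) =
      fun x => ∑ i ∈ s, RandomExpanding.circleD (Φ i) x :=
  circleFun_ext fun t => by
    rw [circleD_coe]; exact (HasDerivAt.fun_sum fun i hi => (h i hi).hasDerivAt t).deriv

end IsSmoothCircleFun

@[simp] theorem circleD_const (c : ℝ) : circleD (fun _ => c) = fun _ => 0 := by
  funext x; simp [circleD]

theorem iterate_circleD_coe (φ : S1 → ℝ) (n : ℕ) (t : ℝ) :
    circleD^[n] φ (t : S1) = iteratedDeriv n (fun s : ℝ => φ (s : S1)) t := by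
  induction n generalizing t with
  | zero => simp
  | succ n ih =>
    rw [Function.iterate_succ_apply', circleD_coe, iteratedDeriv_succ]
    congr 1
    exact funext ih

theorem iterate_circleD_sub {φ ψ : S1 → ℝ} (hφ : IsSmoothCircleFun φ) (hψ : IsSmoothCircleFun ψ)
    (n : ℕ) : circleD^[n] (fun x => φ x - ψ x) = fun x => circleD^[n] φ x - circleD^[n] ψ x := by
  induction n with
  | zero => rfl
  | succ n ih =>
    simp only [Function.iterate_succ_apply', ih]
    exact (hφ.iterate_circleD n).circleD_sub (hψ.iterate_circleD n)

theorem integral_circle (φ : S1 → ℝ) : ∫ x, φ x = ∫ t in (0 : ℝ)..1, φ (t : S1) := by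
  have h := UnitAddCircle.intervalIntegral_preimage 0 φ
  rw [zero_add] at h
  exact h.symm

instance : IsProbabilityMeasure (volume : Measure S1) := ⟨UnitAddCircle.measure_univ⟩

theorem _root_.Continuous.integrable_circle {φ : S1 → ℝ} (hφ : Continuous φ) : Integrable φ :=
  hφ.integrable_of_hasCompactSupport (HasCompactSupport.of_compactSpace φ)

/-- The derivative of a circle map is the derivative of its lift. -/
theorem circleDeriv_coe {E : S1 → S1} {F : ℝ → ℝ} (hF : Differentiable ℝ F)
    (hE : ∀ t : ℝ, E (t : S1) = (F t : S1)) (t : ℝ) : circleDeriv E (t : S1) = deriv F t := by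
  have h1 : (fun s : ℝ => ((AddCircle.equivIoc (1 : ℝ) (-1 / 2))
      (E ((t : S1) + (s : S1)) - E (t : S1)) : ℝ)) =ᶠ[𝓝 0] fun s => F (t + s) - F t := by
    have hc : ContinuousAt (fun s => F (t + s) - F t) 0 := by
      have := hF.continuous
      fun_prop
    have h0 : Set.Ioo (-1 / 2 : ℝ) (1 / 2) ∈ 𝓝 (F (t + 0) - F t) := by
      apply Ioo_mem_nhds <;> norm_num
    filter_upwards [hc.preimage_mem_nhds h0] with s hs
    rw [← AddCircle.coe_add, hE, hE, ← AddCircle.coe_sub, AddCircle.equivIoc,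
      QuotientAddGroup.equivIocMod_coe]
    refine (toIocMod_eq_self one_pos).2 ⟨hs.1, ?_⟩
    have := hs.2
    norm_num
    linarith
  rw [circleDeriv, h1.deriv_eq, deriv_sub_const]
  have h := deriv_comp_const_add F t 0
  rw [add_zero] at h
  exact h

/-! ### Transfer operators of expanding circle maps -/

/-- `F` is a smooth lift of the circle map `E`, with derivative at least one. -/
structure IsExpandingLift (E : S1 → S1) (F : ℝ → ℝ) : Prop where
  contDiff : ContDiff ℝ (⊤ : ℕ∞) F
  map_coe : ∀ t : ℝ, E (t : S1) = (F t : S1)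
  one_le_deriv : ∀ t, 1 ≤ deriv F t

/-- `G` is the inverse of the lift `F` of a circle map of degree `d`. -/
structure IsInverseLift (F G : ℝ → ℝ) (d : ℕ) : Prop where
  degree_pos : 0 < d
  map_add_one : ∀ t, F (t + 1) = F t + d
  contDiff : ContDiff ℝ (⊤ : ℕ∞) G
  left_inv : ∀ t, G (F t) = t
  right_inv : ∀ t, F (G t) = t
  hasDerivAt : ∀ t, HasDerivAt G (deriv F (G t))⁻¹ t

/-- Applied to the defect of a lift under integer translations: it yields the degree of a circle map
and the periodicity of derivatives of torus lifts. -/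
theorem eq_of_continuous_of_forall_int {X : Type*} [TopologicalSpace X] [PreconnectedSpace X]
    {f : X → ℝ} (hf : Continuous f) (hint : ∀ x, ∃ n : ℤ, f x = n) (x y : X) : f x = f y := by
  choose n hn using hint
  have hc : Continuous n := by
    rw [Int.isClosedEmbedding_coe_real.isEmbedding.continuous_iff]
    exact hf.congr hn
  rw [hn, hn, PreconnectedSpace.constant inferInstance hc]

theorem coe_eq_coe_iff {a b : ℝ} : (a : S1) = (b : S1) ↔ ∃ n : ℤ, a = b + n := by
  rw [← sub_eq_zero, ← AddCircle.coe_sub, AddCircle.coe_eq_zero_iff]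
  constructor
  · rintro ⟨n, hn⟩; exact ⟨n, by simp at hn; linarith⟩
  · rintro ⟨n, hn⟩; exact ⟨n, by simp; linarith⟩

namespace IsExpandingLift

variable {E : S1 → S1} {F : ℝ → ℝ}

theorem differentiable (h : IsExpandingLift E F) : Differentiable ℝ F :=
  h.contDiff.differentiable (by simp)

theorem circleDeriv_coe (h : IsExpandingLift E F) (t : ℝ) : circleDeriv E (t : S1) = deriv F t :=
  RandomExpanding.circleDeriv_coe h.differentiable h.map_coe t

theorem continuous (h : IsExpandingLift E F) : Continuous E := by
  rw [continuous_circle_iff]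
  simp only [h.map_coe]
  exact (AddCircle.continuous_mk' 1).comp h.contDiff.continuous

/-- The integrated form of `F' ≥ 1`; it gives both injectivity of the lift and its divergence at
`±∞`. -/
theorem monotone_sub_id (h : IsExpandingLift E F) : Monotone fun t => F t - t := by
  refine monotone_of_deriv_nonneg (h.differentiable.sub differentiable_id) fun t => ?_
  have hd : deriv (fun t => F t - t) t = deriv F t - 1 :=
    ((h.differentiable t).hasDerivAt.sub (hasDerivAt_id t)).deriv
  rw [hd]
  linarith [h.one_le_deriv t]

theorem strictMono (h : IsExpandingLift E F) : StrictMono F := fun a b hab => by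
  have := h.monotone_sub_id hab.le
  simp only at this
  linarith

theorem surjective (h : IsExpandingLift E F) : Function.Surjective F := by
  refine h.contDiff.continuous.surjective ?_ ?_
  · refine tendsto_atTop_mono' _ ?_ (tendsto_atTop_add_const_right atTop (F 0) tendsto_id)
    filter_upwards [eventually_ge_atTop (0 : ℝ)] with t ht
    have := h.monotone_sub_id ht
    simp only [id] at this ⊢
    linarith
  · refine tendsto_atBot_mono' _ ?_ (tendsto_atBot_add_const_right atBot (F 0) tendsto_id)
    filter_upwards [eventually_le_atBot (0 : ℝ)] with t ht
    have := h.monotone_sub_id ht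
    simp only [id] at this ⊢
    linarith

theorem exists_degree (h : IsExpandingLift E F) : ∃ d : ℕ, 0 < d ∧ ∀ t, F (t + 1) = F t + d := by
  have hc : Continuous fun t => F (t + 1) - F t := by
    have := h.contDiff.continuous
    fun_prop
  have hint : ∀ t, ∃ n : ℤ, F (t + 1) - F t = n := fun t => by
    obtain ⟨n, hn⟩ := coe_eq_coe_iff.1 (show (F (t + 1) : S1) = F t by
      rw [← h.map_coe, ← h.map_coe, AddCircle.coe_add, AddCircle.coe_period, add_zero])
    exact ⟨n, by linarith⟩
  obtain ⟨n, hn⟩ := hint 0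
  have hpos : (0 : ℝ) < n := by
    rw [← hn, sub_pos]; exact h.strictMono (by norm_num)
  have hn0 : 0 < n := by exact_mod_cast hpos
  lift n to ℕ using hn0.le
  refine ⟨n, by exact_mod_cast hn0, fun t => ?_⟩
  have := eq_of_continuous_of_forall_int hc hint t 0
  rw [hn] at this
  push_cast at this
  linarith

theorem exists_isInverseLift (h : IsExpandingLift E F) : ∃ G d, IsInverseLift F G d := by
  obtain ⟨d, hd, hFd⟩ := h.exists_degree
  let Φ : ℝ ≃ₜ ℝ := (h.strictMono.orderIsoOfSurjective F h.surjective).toHomeomorph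
  have hne : ∀ t, deriv F t ≠ 0 := fun t => (zero_lt_one.trans_le (h.one_le_deriv t)).ne'
  have hr : ∀ t, F (Φ.symm t) = t := Φ.apply_symm_apply
  refine ⟨Φ.symm, d, hd, hFd, ?_, Φ.symm_apply_apply, hr, fun t => ?_⟩
  · exact Φ.contDiff_symm_deriv hne (fun t => (h.differentiable t).hasDerivAt) h.contDiff
  · exact HasDerivAt.of_local_left_inverse Φ.symm.continuous.continuousAt
      (h.differentiable _).hasDerivAt (hne _) (Eventually.of_forall hr)

end IsExpandingLift

namespace IsInverseLift

variable {E : S1 → S1} {F G : ℝ → ℝ} {d : ℕ}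

theorem map_add_int (h : IsInverseLift F G d) (t : ℝ) (m : ℤ) : F (t + m) = F t + d * m := by
  induction m using Int.induction_on with
  | zero => simp
  | succ m ih =>
    have := h.map_add_one (t + m)
    push_cast at ih ⊢
    rw [← add_assoc, this, ih]; ring
  | pred m ih =>
    have := h.map_add_one (t + (-m - 1))
    push_cast at ih ⊢
    rw [show t + (-(m : ℝ) - 1) + 1 = t + -m by ring, ih] at this
    linarith

/-- Modulo one, `G` has period `d`, so the inverse branches over `t` are `G (t + i)` for `i < d`. -/
theorem inv_add_degree_mul (h : IsInverseLift F G d) (t : ℝ) (m : ℤ) :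
    G (t + d * m) = G t + m := by
  rw [← h.left_inv (G t + m), h.map_add_int, h.right_inv]

/-- The fibre of a point under a circle map of degree `d`. -/
theorem fibre_eq (h : IsInverseLift F G d) (hE : IsExpandingLift E F) (t : ℝ) :
    {y : S1 | E y = (t : S1)} =
      ((Finset.range d).image fun i : ℕ => ((G (t + i) : ℝ) : S1) : Finset S1) := by
  ext y
  induction y using QuotientAddGroup.induction_on with
  | H s =>
    have hd : (0 : ℤ) < d := by exact_mod_cast h.degree_pos
    simp only [Set.mem_ofPred_eq, Finset.coe_image, Finset.coe_range, Set.mem_image, Set.mem_Iio]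
    constructor
    · intro hs
      obtain ⟨m, hm⟩ := coe_eq_coe_iff.1 ((hE.map_coe s).symm.trans hs)
      -- The residue of `m` modulo `d` selects the branch; the quotient `m / d` is an integer
      -- translation, invisible on the circle.
      refine ⟨(m % d).toNat, ?_, ?_⟩
      · have := Int.emod_lt_of_pos m hd
        omega
      · refine (coe_eq_coe_iff.2 ⟨m / d, ?_⟩).symm
        rw [← h.inv_add_degree_mul, ← h.left_inv s, hm]
        congr 1
        have h1 : (((m % d).toNat : ℤ) : ℝ) = ((m % d : ℤ) : ℝ) := by
          rw [Int.toNat_of_nonneg (Int.emod_nonneg m hd.ne')]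
        have h2 : ((m % d : ℤ) : ℝ) + d * ((m / d : ℤ) : ℝ) = m := by
          exact_mod_cast Int.emod_add_mul_ediv m d
        push_cast at h1
        rw [h1]
        linarith
    · rintro ⟨i, -, hi⟩
      rw [← hi]
      refine (hE.map_coe _).trans ?_
      rw [h.right_inv]
      exact coe_eq_coe_iff.2 ⟨i, by simp⟩

theorem injOn (h : IsInverseLift F G d) (t : ℝ) :
    Set.InjOn (fun i : ℕ => ((G (t + i) : ℝ) : S1)) (Finset.range d) := by
  intro i hi j hj hij
  obtain ⟨m, hm⟩ := coe_eq_coe_iff.1 hij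
  rw [← h.inv_add_degree_mul] at hm
  have h1 := congrArg F hm
  rw [h.right_inv, h.right_inv] at h1
  have h2 : (i : ℤ) = j + d * m := by
    have : (i : ℝ) = j + d * m := by linarith
    exact_mod_cast this
  have h3 : ((i : ℤ)) % d = (j : ℤ) % d := by rw [h2]; simp
  simp only [Finset.coe_range, Set.mem_Iio] at hi hj
  exact_mod_cast (Int.emod_eq_of_lt (by positivity) (by exact_mod_cast hi)).symm.trans
    (h3.trans (Int.emod_eq_of_lt (by positivity) (by exact_mod_cast hj)))

theorem transferOp_eq_sum (h : IsInverseLift F G d) (hE : IsExpandingLift E F) (φ : S1 → ℝ)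
    (t : ℝ) : transferOp E φ (t : S1) =
      ∑ i ∈ Finset.range d, φ (G (t + i) : S1) / circleDeriv E (G (t + i) : S1) := by
  rw [transferOp, h.fibre_eq hE, finsum_mem_coe_finset, Finset.sum_image (h.injOn t)]

theorem transferOp_coe (h : IsInverseLift F G d) (hE : IsExpandingLift E F) (φ : S1 → ℝ)
    (t : ℝ) : transferOp E φ (t : S1) =
      ∑ i ∈ Finset.range d, φ (G (t + i) : S1) * deriv G (t + i) := by
  rw [h.transferOp_eq_sum hE]
  refine Finset.sum_congr rfl fun i _ => ?_
  rw [hE.circleDeriv_coe, (h.hasDerivAt _).deriv, div_eq_mul_inv]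

end IsInverseLift

namespace IsExpandingLift

variable {E : S1 → S1} {F : ℝ → ℝ} {φ ψ : S1 → ℝ}

theorem one_le_circleDeriv (h : IsExpandingLift E F) (x : S1) : 1 ≤ circleDeriv E x := by
  induction x using QuotientAddGroup.induction_on with
  | H t => exact (h.one_le_deriv t).trans_eq (h.circleDeriv_coe t).symm

theorem isSmoothCircleFun_circleDeriv (h : IsExpandingLift E F) :
    IsSmoothCircleFun (circleDeriv E) := by
  unfold IsSmoothCircleFun
  rw [funext h.circleDeriv_coe]
  exact ((contDiff_infty_iff_deriv (𝕜 := ℝ)).1 h.contDiff).2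

theorem finite_fibre (h : IsExpandingLift E F) (x : S1) : {y : S1 | E y = x}.Finite := by
  obtain ⟨G, d, hG⟩ := h.exists_isInverseLift
  induction x using QuotientAddGroup.induction_on with
  | H t => exact (hG.fibre_eq h t) ▸ Finset.finite_toSet _

theorem transferOp_add (h : IsExpandingLift E F) (φ ψ : S1 → ℝ) :
    transferOp E (fun x => φ x + ψ x) = fun x => transferOp E φ x + transferOp E ψ x := by
  funext x
  rw [transferOp, transferOp, transferOp, ← finsum_mem_add_distrib (h.finite_fibre x)]
  simp only [add_div]

theorem transferOp_const_mul (h : IsExpandingLift E F) (c : ℝ) (φ : S1 → ℝ) :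
    transferOp E (fun x => c * φ x) = fun x => c * transferOp E φ x := by
  funext x
  simp only [transferOp, finsum_mem_eq_finite_toFinset_sum _ (h.finite_fibre x), Finset.mul_sum,
    mul_div_assoc]

theorem transferOp_sub (h : IsExpandingLift E F) (φ ψ : S1 → ℝ) :
    transferOp E (fun x => φ x - ψ x) = fun x => transferOp E φ x - transferOp E ψ x := by
  have := h.transferOp_add φ (fun x => (-1) * ψ x)
  rw [h.transferOp_const_mul] at this
  simpa [sub_eq_add_neg] using this

theorem transferOp_mono (h : IsExpandingLift E F) (hle : ∀ x, φ x ≤ ψ x) (x : S1) :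
    transferOp E φ x ≤ transferOp E ψ x := by
  simp only [transferOp, finsum_mem_eq_finite_toFinset_sum _ (h.finite_fibre x)]
  refine Finset.sum_le_sum fun y _ => ?_
  have := h.one_le_circleDeriv y
  gcongr
  exact hle y

theorem transferOp_zero (E : S1 → S1) : transferOp E (fun _ => 0) = fun _ => 0 := by
  funext x
  simp [transferOp]

theorem transferOp_nonneg (h : IsExpandingLift E F) (hφ : ∀ x, 0 ≤ φ x) (x : S1) :
    0 ≤ transferOp E φ x := by
  have := h.transferOp_mono hφ x
  rwa [transferOp_zero] at this

theorem abs_transferOp_le (h : IsExpandingLift E F) (hle : ∀ x, |φ x| ≤ ψ x) (x : S1) :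
    |transferOp E φ x| ≤ transferOp E ψ x := by
  rw [abs_le]
  constructor
  · have := h.transferOp_mono (φ := fun x => (-1) * ψ x) (ψ := φ)
      (fun x => by linarith [(abs_le.1 (hle x)).1]) x
    rw [h.transferOp_const_mul] at this
    linarith
  · exact h.transferOp_mono (fun x => (abs_le.1 (hle x)).2) x

theorem isSmoothCircleFun_transferOp (h : IsExpandingLift E F) (hφ : IsSmoothCircleFun φ) :
    IsSmoothCircleFun (transferOp E φ) := by
  obtain ⟨G, d, hG⟩ := h.exists_isInverseLift
  unfold IsSmoothCircleFun
  rw [funext (hG.transferOp_coe h φ)]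
  have hG' : ContDiff ℝ (⊤ : ℕ∞) (deriv G) := ((contDiff_infty_iff_deriv (𝕜 := ℝ)).1 hG.contDiff).2
  refine ContDiff.sum fun i _ => ?_
  have hadd : ContDiff ℝ (⊤ : ℕ∞) fun t : ℝ => t + i := contDiff_id.add contDiff_const
  exact (ContDiff.comp (g := fun t : ℝ => φ t) hφ (hG.contDiff.comp hadd)).mul (hG'.comp hadd)

theorem continuous_transferOp (h : IsExpandingLift E F) (hφ : Continuous φ) :
    Continuous (transferOp E φ) := by
  obtain ⟨G, d, hG⟩ := h.exists_isInverseLift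
  rw [continuous_circle_iff, funext (hG.transferOp_coe h φ)]
  have hG' : Continuous (deriv G) := hG.contDiff.continuous_deriv (by simp)
  have hGc := hG.contDiff.continuous
  have hm : Continuous ((↑) : ℝ → S1) := AddCircle.continuous_mk' 1
  fun_prop

/-- The derivative of `M φ` is `M ((φ / E')')`. -/
theorem circleD_transferOp (h : IsExpandingLift E F) (hφ : IsSmoothCircleFun φ) :
    circleD (transferOp E φ) = transferOp E (circleD fun x => (circleDeriv E x)⁻¹ * φ x) := by
  obtain ⟨G, d, hG⟩ := h.exists_isInverseLift
  have hψ : IsSmoothCircleFun fun x => (circleDeriv E x)⁻¹ * φ x :=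
    (h.isSmoothCircleFun_circleDeriv.inv fun x =>
      (zero_lt_one.trans_le (h.one_le_circleDeriv x)).ne').mul hφ
  refine circleFun_ext fun t => ?_
  rw [circleD_coe, funext (hG.transferOp_eq_sum h φ), hG.transferOp_coe h]
  refine (HasDerivAt.fun_sum fun i _ => ?_).deriv
  have h1 := (hψ.hasDerivAt (G (t + i))).scomp t ((hG.hasDerivAt (t + i)).comp_add_const t i)
  rw [(hG.hasDerivAt _).deriv]
  simp only [Function.comp_def, smul_eq_mul] at h1
  convert h1 using 1
  · funext s; rw [div_eq_inv_mul]
  · ring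

/-- The duality between the transfer operator and the composition operator. -/
theorem integral_transferOp_mul (h : IsExpandingLift E F) (hφ : Continuous φ) (hψ : Continuous ψ) :
    ∫ x, transferOp E φ x * ψ x = ∫ x, φ x * ψ (E x) := by
  obtain ⟨G, d, hG⟩ := h.exists_isInverseLift
  have hG' : Continuous (deriv G) := hG.contDiff.continuous_deriv (by simp)
  have hGc := hG.contDiff.continuous
  have hm : Continuous ((↑) : ℝ → S1) := AddCircle.continuous_mk' 1
  have hEc := h.continuous
  let k : ℝ → ℝ := fun t => φ (t : S1) * ψ (E (t : S1))
  have hk : Continuous k := by fun_prop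
  let g : ℝ → ℝ := fun y => k (G y) * deriv G y
  have hg : Continuous g := by fun_prop
  have hkp : Function.Periodic k 1 := fun t => by
    simp only [k, AddCircle.coe_add, AddCircle.coe_period, add_zero]
  have h1 : ∀ t : ℝ, transferOp E φ (t : S1) * ψ (t : S1) = ∑ i ∈ Finset.range d, g (t + i) := by
    intro t
    rw [hG.transferOp_coe h, Finset.sum_mul]
    refine Finset.sum_congr rfl fun i _ => ?_
    simp only [g, k, h.map_coe, hG.right_inv]
    rw [show ((t + i : ℝ) : S1) = (t : S1) from coe_eq_coe_iff.2 ⟨i, by simp⟩]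
    ring
  rw [integral_circle, integral_circle]
  simp only [h1]
  rw [intervalIntegral.integral_finsetSum (f := fun (i : ℕ) (t : ℝ) => g (t + i)) fun i _ =>
    (show Continuous fun t : ℝ => g (t + i) by fun_prop).intervalIntegrable _ _]
  -- The `d` branches over one period are unrolled into a single integral over `[0, d]`, which the
  -- substitution `y = G t` maps onto one period `[G 0, G 0 + 1]`.
  have h2 : ∀ i ∈ Finset.range d, ∫ t in (0 : ℝ)..1, g (t + i) =
      ∫ t in ((i : ℕ) : ℝ)..((i + 1 : ℕ) : ℝ), g t := by
    intro i _
    rw [intervalIntegral.integral_comp_add_right]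
    congr 1 <;> push_cast <;> ring
  rw [Finset.sum_congr rfl h2, intervalIntegral.sum_integral_adjacent_intervals
    fun i _ => hg.intervalIntegrable _ _]
  have h3 := intervalIntegral.integral_comp_mul_deriv (a := ((0 : ℕ) : ℝ)) (b := (d : ℝ)) (g := k)
    (fun t _ => (hG.contDiff.differentiable (by simp) t).hasDerivAt) hG'.continuousOn hk
  have h4 : G d = G 0 + 1 := by simpa using hG.inv_add_degree_mul 0 1
  simp only [Function.comp_def] at h3
  rw [h3, h4, Nat.cast_zero, hkp.intervalIntegral_add_eq (G 0) 0, zero_add]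

theorem integral_transferOp (h : IsExpandingLift E F) (hφ : Continuous φ) :
    ∫ x, transferOp E φ x = ∫ x, φ x := by
  simpa using h.integral_transferOp_mul hφ (continuous_const (y := (1 : ℝ)))

theorem id : IsExpandingLift (fun x => x) (fun t => t) :=
  ⟨contDiff_id, fun _ => rfl, fun t => by simp⟩

theorem comp {E' : S1 → S1} {F' : ℝ → ℝ} (h' : IsExpandingLift E' F') (h : IsExpandingLift E F) :
    IsExpandingLift (E' ∘ E) (F' ∘ F) where
  contDiff := h'.contDiff.comp h.contDiff
  map_coe t := by rw [Function.comp_apply, h.map_coe, h'.map_coe]; rfl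
  one_le_deriv t := by
    rw [deriv_comp t (h'.differentiable _) (h.differentiable _)]
    nlinarith [h'.one_le_deriv (F t), h.one_le_deriv t]

end IsExpandingLift

/-- The test function `u - v` makes `∫ (u - v)²` vanish. -/
theorem eq_of_forall_integral_mul_eq {u v : S1 → ℝ} (hu : Continuous u) (hv : Continuous v)
    (huv : ∀ ψ : S1 → ℝ, Continuous ψ → ∫ x, u x * ψ x = ∫ x, v x * ψ x) : u = v := by
  have h1 := huv (fun x => u x - v x) (hu.sub hv)
  have h2 : ∫ x, (u x - v x) ^ 2 = 0 := by
    have : ∀ x, (u x - v x) ^ 2 = u x * (u x - v x) - v x * (u x - v x) := fun x => by ring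
    simp only [this]
    rw [integral_sub (Continuous.integrable_circle (by fun_prop))
      (Continuous.integrable_circle (by fun_prop)), h1, sub_self]
  have hc : Continuous fun x => (u x - v x) ^ 2 := by fun_prop
  rw [integral_eq_zero_iff_of_nonneg (fun x => sq_nonneg _) (Continuous.integrable_circle hc)] at h2
  have h3 := (Continuous.ae_eq_iff_eq volume hc continuous_const).1 h2
  funext x
  have := congrFun h3 x
  exact sub_eq_zero.1 (pow_eq_zero_iff (n := 2) (by norm_num) |>.1 this)

/-- Transfer operators are functorial. -/
theorem transferOp_comp {E E' : S1 → S1} {F F' : ℝ → ℝ} (h : IsExpandingLift E F)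
    (h' : IsExpandingLift E' F') {φ : S1 → ℝ} (hφ : Continuous φ) :
    transferOp (E' ∘ E) φ = transferOp E' (transferOp E φ) := by
  have hc := h.continuous_transferOp hφ
  -- Duality replaces the bookkeeping of fibres of fibres: composition operators compose trivially.
  refine eq_of_forall_integral_mul_eq ((h'.comp h).continuous_transferOp hφ)
    (h'.continuous_transferOp hc) fun ψ hψ => ?_
  rw [(h'.comp h).integral_transferOp_mul hφ hψ, h'.integral_transferOp_mul hc hψ]
  exact (h.integral_transferOp_mul hφ (hψ.comp h'.continuous)).symm

theorem transferOp_id (φ : S1 → ℝ) : transferOp (fun x => x) φ = φ := by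
  funext x
  have h1 : circleDeriv (fun x => x) x = 1 := by
    induction x using QuotientAddGroup.induction_on with
    | H t => exact (IsExpandingLift.id.circleDeriv_coe t).trans (by simp)
  simp [transferOp, h1]

/-! ### Families of circle functions with uniformly bounded derivatives -/

/-- The derivatives of order at most `n` of the functions `p i` are bounded uniformly in `i`. -/
def UnifBdd {ι : Type*} (n : ℕ) (p : ι → S1 → ℝ) : Prop :=
  ∀ j ≤ n, ∃ K, ∀ i x, |circleD^[j] (p i) x| ≤ K

namespace UnifBdd

variable {ι : Type*} {n : ℕ} {p q : ι → S1 → ℝ}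

theorem mono {m : ℕ} (h : UnifBdd n p) (hmn : m ≤ n) : UnifBdd m p :=
  fun j hj => h j (hj.trans hmn)

theorem zero_iff : UnifBdd 0 p ↔ ∃ K, ∀ i x, |p i x| ≤ K := by
  simp [UnifBdd]

theorem succ_iff : UnifBdd (n + 1) p ↔
    (∃ K, ∀ i x, |p i x| ≤ K) ∧ UnifBdd n (fun i => circleD (p i)) := by
  constructor
  · exact fun h => ⟨h 0 (Nat.zero_le _), fun j hj => h (j + 1) (Nat.succ_le_succ hj)⟩
  · rintro ⟨h0, h1⟩ (_ | j) hj
    · exact h0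
    · exact h1 j (Nat.succ_le_succ_iff.1 hj)

theorem circleD (h : UnifBdd (n + 1) p) : UnifBdd n (fun i => circleD (p i)) := (succ_iff.1 h).2

theorem const (c : ℝ) : UnifBdd n (fun (_ : ι) (_ : S1) => c) := by
  induction n generalizing c with
  | zero => exact zero_iff.2 ⟨|c|, fun _ _ => le_rfl⟩
  | succ n ih => exact succ_iff.2 ⟨⟨|c|, fun _ _ => le_rfl⟩, by simpa using ih 0⟩

theorem add (hp : ∀ i, IsSmoothCircleFun (p i)) (hq : ∀ i, IsSmoothCircleFun (q i))
    (h : UnifBdd n p) (h' : UnifBdd n q) : UnifBdd n (fun i x => p i x + q i x) := by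
  induction n generalizing p q with
  | zero =>
    obtain ⟨K, hK⟩ := zero_iff.1 h
    obtain ⟨L, hL⟩ := zero_iff.1 h'
    exact zero_iff.2 ⟨K + L, fun i x => (abs_add_le _ _).trans (add_le_add (hK i x) (hL i x))⟩
  | succ n ih =>
    obtain ⟨⟨K, hK⟩, h1⟩ := succ_iff.1 h
    obtain ⟨⟨L, hL⟩, h1'⟩ := succ_iff.1 h'
    refine succ_iff.2
      ⟨⟨K + L, fun i x => (abs_add_le _ _).trans (add_le_add (hK i x) (hL i x))⟩, ?_⟩
    simp only [(hp _).circleD_add (hq _)]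
    exact ih (fun i => (hp i).circleD) (fun i => (hq i).circleD) h1 h1'

theorem mul (hp : ∀ i, IsSmoothCircleFun (p i)) (hq : ∀ i, IsSmoothCircleFun (q i))
    (h : UnifBdd n p) (h' : UnifBdd n q) : UnifBdd n (fun i x => p i x * q i x) := by
  have key : ∀ {p q : ι → S1 → ℝ}, (∃ K, ∀ i x, |p i x| ≤ K) → (∃ K, ∀ i x, |q i x| ≤ K) →
      ∃ K, ∀ i x, |p i x * q i x| ≤ K := by
    rintro p q ⟨K, hK⟩ ⟨L, hL⟩
    refine ⟨K * L, fun i x => ?_⟩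
    rw [abs_mul]
    exact mul_le_mul (hK i x) (hL i x) (abs_nonneg _) ((abs_nonneg _).trans (hK i x))
  induction n generalizing p q with
  | zero => exact zero_iff.2 (key (zero_iff.1 h) (zero_iff.1 h'))
  | succ n ih =>
    refine succ_iff.2 ⟨key (succ_iff.1 h).1 (succ_iff.1 h').1, ?_⟩
    simp only [(hp _).circleD_mul (hq _)]
    exact add (fun i => (hp i).circleD.mul (hq i)) (fun i => (hp i).mul (hq i).circleD)
      (ih (fun i => (hp i).circleD) hq h.circleD (h'.mono n.le_succ))
      (ih hp (fun i => (hq i).circleD) (h.mono n.le_succ) h'.circleD)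

theorem pow (hp : ∀ i, IsSmoothCircleFun (p i)) (h : UnifBdd n p) (r : ℕ) :
    UnifBdd n (fun i x => p i x ^ r) := by
  induction r with
  | zero => simpa using const 1
  | succ r ih =>
    simp only [pow_succ]
    exact mul (p := fun i x => p i x ^ r) (fun i => ContDiff.pow (hp i) r) hp ih h

/-- The reciprocals of a family bounded below, with uniformly bounded derivatives. -/
theorem inv (hp : ∀ i, IsSmoothCircleFun (p i)) (h1 : ∀ i x, 1 ≤ p i x)
    (h : ∀ j < n, ∃ K, ∀ i x, |RandomExpanding.circleD^[j + 1] (p i) x| ≤ K) :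
    UnifBdd n (fun i x => (p i x)⁻¹) := by
  have h0 : ∀ i x, p i x ≠ 0 := fun i x => (zero_lt_one.trans_le (h1 i x)).ne'
  have hb : ∃ K, ∀ i x, |(p i x)⁻¹| ≤ K := ⟨1, fun i x => by
    rw [abs_of_nonneg (inv_nonneg.2 (zero_le_one.trans (h1 i x)))]
    exact inv_le_one_of_one_le₀ (h1 i x)⟩
  have hs : ∀ i, IsSmoothCircleFun (fun x => (p i x)⁻¹) := fun i => (hp i).inv (h0 i)
  induction n with
  | zero => exact zero_iff.2 hb
  | succ n ih =>
    refine succ_iff.2 ⟨hb, ?_⟩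
    have ih := ih fun j hj => h j (hj.trans n.lt_succ_self)
    have hq : UnifBdd n (fun i => RandomExpanding.circleD (p i)) :=
      fun j hj => h j (Nat.lt_succ_of_le hj)
    -- Since `(1/p)' = -p' · p⁻¹ · p⁻¹`, only derivatives of `p` of positive order enter, and no
    -- upper bound on `p` is needed.
    have := mul (fun i => (IsSmoothCircleFun.const (-1)).mul (hp i).circleD)
      (fun i => (hs i).mul (hs i))
      (mul (fun i => IsSmoothCircleFun.const (-1)) (fun i => (hp i).circleD) (const (-1)) hq)
      (mul hs hs ih ih)
    simp only [(hp _).circleD_inv (h0 _)]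
    convert this using 3
    field_simp

end UnifBdd

/-- The operator `φ ↦ (e φ)'`, where `e` is the reciprocal of the derivative of a circle map. -/
noncomputable def twistedD (e φ : S1 → ℝ) : S1 → ℝ := circleD fun x => e x * φ x

theorem IsSmoothCircleFun.twistedD {e φ : S1 → ℝ} (he : IsSmoothCircleFun e)
    (hφ : IsSmoothCircleFun φ) : IsSmoothCircleFun (twistedD e φ) := (he.mul hφ).circleD

/-- The iterates of `φ ↦ (e φ)'` are differential operators with leading coefficient `e ^ r`. -/
theorem exists_iterate_twistedD_eq {ι : Type*} {n : ℕ} {e : ι → S1 → ℝ}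
    (he : ∀ i, IsSmoothCircleFun (e i)) (hb : UnifBdd n e) (r : ℕ) (hr : r ≤ n) :
    ∃ p : ℕ → ι → S1 → ℝ, (∀ j i, IsSmoothCircleFun (p j i)) ∧ (∀ j, UnifBdd (n - r) (p j)) ∧
      ∀ i φ, IsSmoothCircleFun φ → ∀ x, (twistedD (e i))^[r] φ x =
        e i x ^ r * circleD^[r] φ x + ∑ j ∈ Finset.range r, p j i x * circleD^[j] φ x := by
  induction r with
  | zero =>
    exact ⟨fun _ _ _ => 0, fun _ _ => .const 0, fun _ => .const 0, fun i φ _ x => by simp⟩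
  | succ r ih =>
    obtain ⟨p, hp, hpb, heq⟩ := ih (r.le_succ.trans hr)
    obtain ⟨m, hm⟩ : ∃ m, n - r = m + 1 := ⟨n - r - 1, by omega⟩
    have hm' : n - (r + 1) = m := by omega
    rw [hm] at hpb
    have hpow : ∀ i, IsSmoothCircleFun fun x => e i x ^ (r + 1) := fun i => ContDiff.pow (he i) _
    have hpowb : UnifBdd (m + 1) fun i x => e i x ^ (r + 1) :=
      (UnifBdd.pow he (hb.mono (by omega)) (r + 1))
    have hep : ∀ j i, IsSmoothCircleFun fun x => e i x * p j i x := fun j i => (he i).mul (hp j i)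
    have hepb : ∀ j, UnifBdd (m + 1) fun i x => e i x * p j i x := fun j =>
      UnifBdd.mul he (hp j) (hb.mono (by omega)) (hpb j)
    -- `q₁` collects the terms where the new derivative falls on a coefficient (for `j = r`, on the
    -- leading one), `q₂` those where it falls on `φ` and raises the order by one. The case `j = 0`
    -- of `q₂` guards against truncated subtraction.
    let q₁ : ℕ → ι → S1 → ℝ := fun j i =>
      if j < r then circleD (fun x => e i x * p j i x) else circleD (fun x => e i x ^ (r + 1))
    let q₂ : ℕ → ι → S1 → ℝ := fun j i x => if j = 0 then 0 else e i x * p (j - 1) i x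
    have hq₁ : ∀ j i, IsSmoothCircleFun (q₁ j i) := fun j i => by
      simp only [q₁]
      split_ifs
      exacts [(hep j i).circleD, (hpow i).circleD]
    have hq₂ : ∀ j i, IsSmoothCircleFun (q₂ j i) := fun j i => by
      simp only [q₂]
      split_ifs
      exacts [.const 0, hep _ i]
    refine ⟨fun j i x => q₁ j i x + q₂ j i x, fun j i => (hq₁ j i).add (hq₂ j i), fun j => ?_, ?_⟩
    · rw [hm']
      refine UnifBdd.add (hq₁ j) (hq₂ j) ?_ ?_
      · simp only [q₁]
        split_ifs
        exacts [(hepb j).circleD, hpowb.circleD]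
      · simp only [q₂]
        split_ifs
        exacts [.const 0, (hepb _).mono m.le_succ]
    · intro i φ hφ x
      rw [Function.iterate_succ_apply']
      have hfun : (twistedD (e i))^[r] φ = fun x => e i x ^ r * circleD^[r] φ x +
          ∑ j ∈ Finset.range r, p j i x * circleD^[j] φ x := funext (heq i φ hφ)
      have hfun' : (fun x => e i x * (twistedD (e i))^[r] φ x) = fun x =>
          e i x ^ (r + 1) * circleD^[r] φ x +
          ∑ j ∈ Finset.range r, (e i x * p j i x) * circleD^[j] φ x := by
        funext x
        rw [hfun, mul_add, Finset.mul_sum]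
        congr 1
        · ring
        · exact Finset.sum_congr rfl fun j _ => by ring
      have hD := fun j => hφ.iterate_circleD j
      rw [twistedD, hfun', ((hpow i).mul (hD r)).circleD_add
        (IsSmoothCircleFun.sum fun j _ => (hep j i).mul (hD j)),
        IsSmoothCircleFun.circleD_sum fun j _ => (hep j i).mul (hD j), (hpow i).circleD_mul (hD r)]
      simp only [(hep _ i).circleD_mul (hD _), Finset.sum_add_distrib, add_mul]
      have e1 : ∑ j ∈ Finset.range (r + 1), q₁ j i x * circleD^[j] φ x =
          ∑ j ∈ Finset.range r, circleD (fun x => e i x * p j i x) x * circleD^[j] φ x +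
            circleD (fun x => e i x ^ (r + 1)) x * circleD^[r] φ x := by
        rw [Finset.sum_range_succ]
        congr 1
        · refine Finset.sum_congr rfl fun j hj => ?_
          simp only [q₁, if_pos (Finset.mem_range.1 hj)]
        · simp only [q₁, lt_irrefl, if_false]
      have e2 : ∑ j ∈ Finset.range (r + 1), q₂ j i x * circleD^[j] φ x =
          ∑ j ∈ Finset.range r, e i x * p j i x * circleD (circleD^[j] φ) x := by
        rw [Finset.sum_range_succ']
        simp only [q₂, Nat.add_sub_cancel, Function.iterate_succ_apply']
        simp
      rw [e1, e2, Function.iterate_succ_apply']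
      ring

/-! ### Uniformly expanding classes of circle maps -/

/-- Circle maps with derivative at least `l`, whose derivatives of order `2, …, N + 1` are bounded
by `B`. -/
structure ExpClass (N : ℕ) (l B : ℝ) (E : S1 → S1) : Prop where
  exists_lift : ∃ F, IsExpandingLift E F
  le_deriv : ∀ x, l ≤ circleDeriv E x
  bound : ∀ j < N, ∀ x, |circleD^[j + 1] (circleDeriv E) x| ≤ B

theorem ExpClass.mono {N N' : ℕ} {l B : ℝ} {E : S1 → S1} (h : ExpClass N l B E) (hN : N' ≤ N) :
    ExpClass N' l B E :=
  ⟨h.exists_lift, h.le_deriv, fun j hj => h.bound j (hj.trans_le hN)⟩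

/-- Differentiation passes through `transferOp E` at the price of the twist, so derivatives of `M φ`
are `M` applied to a differential operator. Smoothness is carried along so that the induction can
differentiate again. -/
theorem iterate_circleD_transferOp {E : S1 → S1} {F : ℝ → ℝ} (h : IsExpandingLift E F)
    {φ : S1 → ℝ} (hφ : IsSmoothCircleFun φ) (r : ℕ) :
    circleD^[r] (transferOp E φ) =
      transferOp E ((twistedD fun x => (circleDeriv E x)⁻¹)^[r] φ) ∧
    IsSmoothCircleFun ((twistedD fun x => (circleDeriv E x)⁻¹)^[r] φ) := by
  have he := h.isSmoothCircleFun_circleDeriv.inv fun x =>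
      (zero_lt_one.trans_le (h.one_le_circleDeriv x)).ne'
  induction r with
  | zero => exact ⟨rfl, hφ⟩
  | succ r ih =>
    rw [Function.iterate_succ_apply', Function.iterate_succ_apply', ih.1]
    exact ⟨h.circleD_transferOp ih.2, he.twistedD ih.2⟩

/-- A pointwise Lasota-Yorke inequality, uniform on expanding classes. -/
theorem exists_lasotaYorke (N : ℕ) {l : ℝ} (hl : 1 < l) (B : ℝ) (r : ℕ) (hr : r + 1 ≤ N) :
    ∃ C, 0 ≤ C ∧ ∀ E, ExpClass N l B E → ∀ φ, IsSmoothCircleFun φ → ∀ (w : S1 → ℝ) (c : ℕ → ℝ),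
      (∀ x, 0 ≤ w x) → (∀ j ≤ r + 1, ∀ x, |circleD^[j] φ x| ≤ c j * w x) →
      ∀ x, |circleD^[r + 1] (transferOp E φ) x| ≤
        (l⁻¹ * c (r + 1) + C * ∑ j ∈ Finset.range (r + 1), c j) * transferOp E w x := by
  -- The whole class is the index set of the family, which makes the coefficient bounds uniform over
  -- it.
  let ι := {E : S1 → S1 // ExpClass N l B E}
  let e : ι → S1 → ℝ := fun E x => (circleDeriv E.1 x)⁻¹
  have h1 : ∀ (E : ι) x, 1 ≤ circleDeriv E.1 x := fun E x => hl.le.trans (E.2.le_deriv x)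
  have hq : ∀ E : ι, IsSmoothCircleFun (circleDeriv E.1) := fun E =>
    let ⟨_, hF⟩ := E.2.exists_lift
    hF.isSmoothCircleFun_circleDeriv
  have he : ∀ E : ι, IsSmoothCircleFun (e E) := fun E =>
    (hq E).inv fun x => (zero_lt_one.trans_le (h1 E x)).ne'
  have hb : UnifBdd N e := UnifBdd.inv hq h1 fun j hj => ⟨B, fun E x => E.2.bound j hj x⟩
  obtain ⟨p, -, hpb, heq⟩ := exists_iterate_twistedD_eq he hb (r + 1) hr
  choose K hK using fun j => hpb j 0 (Nat.zero_le _)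
  refine ⟨∑ j ∈ Finset.range (r + 1), |K j|, Finset.sum_nonneg fun j _ => abs_nonneg _, ?_⟩
  intro E hE φ hφ w c hw hc x
  obtain ⟨F, hF⟩ := hE.exists_lift
  rw [(iterate_circleD_transferOp hF hφ (r + 1)).1]
  have := hF.transferOp_const_mul
    (l⁻¹ * c (r + 1) + (∑ j ∈ Finset.range (r + 1), |K j|) * ∑ j ∈ Finset.range (r + 1), c j) w
  -- The operator is positive, so a pointwise bound by a multiple of `w` before applying it
  -- suffices.
  rw [← congrFun this x]
  refine hF.abs_transferOp_le (fun y => ?_) x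
  rw [heq ⟨E, hE⟩ φ hφ y, add_mul]
  have hcw : ∀ j ≤ r + 1, 0 ≤ c j * w y := fun j hj => (abs_nonneg _).trans (hc j hj y)
  refine (abs_add_le _ _).trans (add_le_add ?_ ?_)
  · rw [abs_mul, mul_assoc]
    refine mul_le_mul ?_ (hc _ le_rfl y) (abs_nonneg _) (by positivity)
    have hy := hE.le_deriv y
    have hpos : 0 < circleDeriv E y := by linarith
    rw [abs_of_nonneg (by positivity), pow_succ]
    -- The leading coefficient is at most `l⁻¹ ^ (r + 1)`; a single factor `l⁻¹ < 1` is all that is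
    -- used later.
    calc (circleDeriv E y)⁻¹ ^ r * (circleDeriv E y)⁻¹ ≤ 1 * l⁻¹ := by
          gcongr
          exact pow_le_one₀ (by positivity) (inv_le_one_of_one_le₀ (by linarith))
      _ = l⁻¹ := one_mul _
  · refine (Finset.abs_sum_le_sum_abs _ _).trans ?_
    rw [mul_assoc, Finset.sum_mul, Finset.sum_mul]
    refine Finset.sum_le_sum fun j hj => ?_
    rw [abs_mul]
    have hj' : j ≤ r + 1 := (Finset.mem_range.1 hj).le
    refine mul_le_mul ((hK j ⟨E, hE⟩ y).trans (le_abs_self _)) ((hc j hj' y).trans ?_)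
      (abs_nonneg _) (abs_nonneg _)
    exact Finset.single_le_sum (f := fun j => c j * w y)
      (fun i hi => hcw i (Finset.mem_range.1 hi).le) hj

/-! ### The cone of log-Lipschitz densities -/

/-- Smooth probability densities on the circle with logarithmic derivative bounded by `a`. -/
structure IsConeDensity (a : ℝ) (φ : S1 → ℝ) : Prop where
  smooth : IsSmoothCircleFun φ
  nonneg : ∀ x, 0 ≤ φ x
  abs_circleD_le : ∀ x, |circleD φ x| ≤ a * φ x
  integral_eq_one : ∫ x, φ x = 1

namespace IsConeDensity

variable {a : ℝ} {φ ψ : S1 → ℝ}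

theorem one (ha : 0 ≤ a) : IsConeDensity a (fun _ => 1) :=
  ⟨.const 1, fun _ => zero_le_one, fun x => by simpa using ha, by simp⟩

/-- A Harnack inequality: any two points have lifts at distance at most one. Monotonicity of `φ
e^{at}` replaces the logarithm, since `φ` is only assumed nonnegative. -/
theorem le_exp_mul (h : IsConeDensity a φ) (ha : 0 ≤ a) (x y : S1) :
    φ x ≤ Real.exp a * φ y := by
  induction x using QuotientAddGroup.induction_on with
  | H s =>
    induction y using QuotientAddGroup.induction_on with
    | H t =>
      have hmono : Monotone fun t : ℝ => φ (t : S1) * Real.exp (a * t) := by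
        have hd : ∀ t : ℝ, HasDerivAt (fun t : ℝ => φ (t : S1) * Real.exp (a * t))
            (circleD φ t * Real.exp (a * t) + φ t * (Real.exp (a * t) * (a * 1))) t := fun t =>
          (h.smooth.hasDerivAt t).mul (((hasDerivAt_id t).const_mul a).exp)
        refine monotone_of_deriv_nonneg (fun t => (hd t).differentiableAt) fun t => ?_
        rw [(hd t).deriv]
        have := (abs_le.1 (h.abs_circleD_le t)).1
        have := Real.exp_pos (a * t)
        nlinarith
      -- The representative of `t` modulo one lying in `[s, s + 1]`.
      set t' : ℝ := t - ⌊t - s⌋ with ht'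
      have h1 : s ≤ t' := by linarith [Int.floor_le (t - s)]
      have h2 : t' ≤ s + 1 := by linarith [Int.lt_floor_add_one (t - s)]
      have h3 : (t : S1) = (t' : S1) := coe_eq_coe_iff.2 ⟨⌊t - s⌋, by rw [ht']; ring⟩
      have h4 := hmono h1
      simp only at h4
      have h5 : φ (s : S1) ≤ Real.exp (a * (t' - s)) * φ (t' : S1) := by
        rw [mul_sub, Real.exp_sub, div_mul_eq_mul_div, le_div_iff₀ (Real.exp_pos _)]
        linarith
      refine h5.trans ?_
      rw [h3]
      refine mul_le_mul_of_nonneg_right (Real.exp_le_exp.2 ?_) (h.nonneg _)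
      nlinarith

/-- The Harnack inequality integrated over `y`, with total mass one; integrating over the other
variable gives the lower bound. -/
theorem le_exp (h : IsConeDensity a φ) (ha : 0 ≤ a) (x : S1) : φ x ≤ Real.exp a := by
  have h1 : ∫ _ : S1, φ x ≤ ∫ y : S1, Real.exp a * φ y :=
    integral_mono (integrable_const _) (h.smooth.continuous.integrable_circle.const_mul _)
      (h.le_exp_mul ha x)
  rw [integral_const_mul, h.integral_eq_one] at h1
  simpa using h1

theorem exp_neg_le (h : IsConeDensity a φ) (ha : 0 ≤ a) (x : S1) : Real.exp (-a) ≤ φ x := by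
  have h1 : ∫ y : S1, φ y ≤ ∫ _ : S1, Real.exp a * φ x :=
    integral_mono h.smooth.continuous.integrable_circle (integrable_const _)
      (fun y => h.le_exp_mul ha y x)
  rw [h.integral_eq_one] at h1
  rw [Real.exp_neg, inv_le_iff_one_le_mul₀ (Real.exp_pos a), mul_comm]
  simpa using h1

theorem abs_sub_le (h : IsConeDensity a φ) (h' : IsConeDensity a ψ) (ha : 0 ≤ a) (x : S1) :
    |φ x - ψ x| ≤ Real.exp a := by
  rw [abs_le]
  constructor <;> linarith [h.le_exp ha x, h'.le_exp ha x, h.nonneg x, h'.nonneg x]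

end IsConeDensity

/-- Every smooth positive probability density lies in some cone. -/
theorem exists_isConeDensity {φ : S1 → ℝ} (hφ : IsSmoothCircleFun φ) (h0 : ∀ x, 0 < φ x)
    (h1 : ∫ x, φ x = 1) : ∃ b, ∀ a ≥ b, IsConeDensity a φ := by
  have hc : Continuous fun x => |circleD φ x| / φ x :=
    hφ.circleD.continuous.abs.div hφ.continuous fun x => (h0 x).ne'
  obtain ⟨b, hb⟩ := (isCompact_range hc).bddAbove
  refine ⟨b, fun a ha => ⟨hφ, fun x => (h0 x).le, fun x => ?_, h1⟩⟩
  rw [← div_le_iff₀ (h0 x)]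
  exact (hb ⟨x, rfl⟩).trans ha

/-- Transfer operators of an expanding class contract a cone of densities. -/
theorem exists_transferOp_isConeDensity {N : ℕ} (hN : 1 ≤ N) {l : ℝ} (hl : 1 < l) (B : ℝ) :
    ∃ a₀, 0 ≤ a₀ ∧ ∀ a ≥ a₀, ∃ κ, 0 < κ ∧ κ < 1 ∧ ∀ E, ExpClass N l B E →
      ∀ φ, IsConeDensity a φ → IsConeDensity a (transferOp E φ) ∧
        ∃ φ', IsConeDensity a φ' ∧ ∀ x, transferOp E φ x = (1 - κ) * φ' x + κ := by
  have hl' : l⁻¹ < 1 := inv_lt_one_of_one_lt₀ hl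
  have hl0 : 0 < l⁻¹ := inv_pos.2 (by linarith)
  -- The midpoint of `l⁻¹` and `1`: the new slope is at most `l⁻¹ a + |B|`, where `|B|` bounds
  -- `|E''| / E'²`, and the gap `σ - l⁻¹` absorbs `|B|` once `a ≥ |B| / (σ - l⁻¹)`.
  set σ := (1 + l⁻¹) / 2 with hσ
  have hσ1 : σ < 1 := by linarith
  have hσl : 0 < σ - l⁻¹ := by linarith
  refine ⟨|B| / (σ - l⁻¹), by positivity, fun a ha => ?_⟩
  have ha0 : 0 ≤ a := le_trans (by positivity) ha
  have haB : l⁻¹ * a + |B| ≤ σ * a := by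
    have := (div_le_iff₀ hσl).1 ha
    linarith
  have hexp : Real.exp (-a) ≤ 1 := Real.exp_le_one_iff.2 (by linarith)
  have hexp0 := Real.exp_pos (-a)
  -- Removing `κ` from `M φ` keeps the slope `a` if `σ a M φ ≤ a (M φ - κ)`, that is `κ ≤ (1 - σ) M
  -- φ` for `a > 0`; the lower bound `M φ ≥ e^{-a}` guarantees this.
  refine ⟨(1 - σ) * Real.exp (-a), by nlinarith, by nlinarith, fun E hE φ hφ => ?_⟩
  set κ := (1 - σ) * Real.exp (-a) with hκ
  have hκ1 : 0 < 1 - κ := by nlinarith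
  obtain ⟨F, hF⟩ := hE.exists_lift
  have hsm := hF.isSmoothCircleFun_transferOp hφ.smooth
  have hnn := hF.transferOp_nonneg hφ.nonneg
  have hq := hF.isSmoothCircleFun_circleDeriv
  have hq1 : ∀ x, circleDeriv E x ≠ 0 := fun x =>
    (zero_lt_one.trans_le (hF.one_le_circleDeriv x)).ne'
  have hder : ∀ x, |circleD (transferOp E φ) x| ≤ σ * a * transferOp E φ x := by
    intro x
    rw [hF.circleD_transferOp hφ.smooth, ← congrFun (hF.transferOp_const_mul (σ * a) φ) x]
    refine hF.abs_transferOp_le (fun y => ?_) x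
    rw [(hq.inv hq1).circleD_mul hφ.smooth, hq.circleD_inv hq1]
    have hy := hE.le_deriv y
    have hy0 : 0 < circleDeriv E y := by linarith
    have h1 : |(circleDeriv E y)⁻¹ * circleD φ y| ≤ l⁻¹ * a * φ y := by
      rw [abs_mul, abs_of_pos (inv_pos.2 hy0), mul_assoc]
      exact mul_le_mul (inv_anti₀ (by linarith) hy) (hφ.abs_circleD_le y) (abs_nonneg _) hl0.le
    have h2 : |-circleD (circleDeriv E) y / circleDeriv E y ^ 2 * φ y| ≤ |B| * φ y := by
      rw [abs_mul, abs_of_nonneg (hφ.nonneg y), abs_div, abs_neg, abs_of_pos (pow_pos hy0 2)]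
      refine mul_le_mul_of_nonneg_right ?_ (hφ.nonneg y)
      refine (div_le_self (abs_nonneg _) ?_).trans ((hE.bound 0 hN y).trans (le_abs_self B))
      exact one_le_pow₀ (by linarith)
    refine (abs_add_le _ _).trans ((add_le_add h2 h1).trans ?_)
    nlinarith [hφ.nonneg y]
  have hcone : IsConeDensity a (transferOp E φ) := by
    refine ⟨hsm, hnn, fun x => (hder x).trans ?_, ?_⟩
    · exact mul_le_mul_of_nonneg_right (by nlinarith) (hnn x)
    · rw [hF.integral_transferOp hφ.smooth.continuous, hφ.integral_eq_one]
  refine ⟨hcone, fun x => (1 - κ)⁻¹ * (transferOp E φ x - κ), ⟨?_, fun x => ?_, fun x => ?_, ?_⟩,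
    fun x => by field_simp; ring⟩
  · exact (IsSmoothCircleFun.const _).mul (hsm.sub (.const κ))
  · have := hcone.exp_neg_le ha0 x
    have : κ ≤ Real.exp (-a) := by nlinarith
    exact mul_nonneg (inv_pos.2 hκ1).le (by linarith)
  · rw [(IsSmoothCircleFun.const _).circleD_mul (hsm.sub (.const κ)),
      hsm.circleD_sub (.const κ)]
    simp only [circleD_const, zero_mul, zero_add, sub_zero]
    rw [abs_mul, abs_of_pos (inv_pos.2 hκ1), mul_left_comm]
    refine mul_le_mul_of_nonneg_left ((hder x).trans ?_) (inv_pos.2 hκ1).le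
    have h3 := hcone.exp_neg_le ha0 x
    have h4 : κ ≤ (1 - σ) * transferOp E φ x :=
      mul_le_mul_of_nonneg_left h3 (by linarith)
    nlinarith
  · rw [integral_const_mul, integral_sub hsm.continuous.integrable_circle (integrable_const _),
      hcone.integral_eq_one]
    simp [inv_mul_cancel₀ hκ1.ne']

/-! ### Pullback products of transfer operators -/

/-- The product `M_{s 0} ∘ M_{s 1} ∘ ⋯ ∘ M_{s (n - 1)}` of transfer operators. -/
noncomputable def pullback : ℕ → (ℕ → S1 → S1) → (S1 → ℝ) → S1 → ℝ
  | 0, _, φ => φ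
  | n + 1, s, φ => transferOp (s 0) (pullback n (fun j => s (j + 1)) φ)

/-- The definition peels off the outermost operator; peeling off the innermost one is what makes
successive pullbacks of `1` telescope. -/
theorem pullback_succ' (n : ℕ) (s : ℕ → S1 → S1) (φ : S1 → ℝ) :
    pullback (n + 1) s φ = pullback n s (transferOp (s n) φ) := by
  induction n generalizing s with
  | zero => rfl
  | succ n ih => rw [pullback, ih, pullback]

section

variable {N : ℕ} {l B : ℝ} {s : ℕ → S1 → S1}

theorem IsSmoothCircleFun.pullback (hs : ∀ j, ∃ F, IsExpandingLift (s j) F) {φ : S1 → ℝ}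
    (hφ : IsSmoothCircleFun φ) (n : ℕ) : IsSmoothCircleFun (pullback n s φ) := by
  induction n generalizing s with
  | zero => exact hφ
  | succ n ih =>
    obtain ⟨F, hF⟩ := hs 0
    exact hF.isSmoothCircleFun_transferOp (ih fun j => hs (j + 1))

theorem pullback_sub (hs : ∀ j, ∃ F, IsExpandingLift (s j) F) (φ ψ : S1 → ℝ) (n : ℕ) :
    pullback n s (fun x => φ x - ψ x) = fun x => pullback n s φ x - pullback n s ψ x := by
  induction n generalizing s with
  | zero => rfl
  | succ n ih =>
    obtain ⟨F, hF⟩ := hs 0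
    rw [pullback, ih fun j => hs (j + 1), hF.transferOp_sub]
    rfl

theorem IsConeDensity.pullback {a : ℝ} {C : Set (S1 → S1)}
    (hC : ∀ E ∈ C, ∀ φ, IsConeDensity a φ → IsConeDensity a (transferOp E φ))
    (hs : ∀ j, s j ∈ C) {φ : S1 → ℝ} (hφ : IsConeDensity a φ) (n : ℕ) :
    IsConeDensity a (pullback n s φ) := by
  induction n generalizing s with
  | zero => exact hφ
  | succ n ih => exact hC _ (hs 0) _ (ih fun j => hs (j + 1))

/-- The split-off constants cancel, and the remainder is again a difference of cone densities, so
the factor `1 - κ` is gained at every step. -/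
theorem exists_pullback_sub_eq {a κ : ℝ} (hs : ∀ j, ∃ F, IsExpandingLift (s j) F)
    (hκ : ∀ j φ, IsConeDensity a φ →
      ∃ φ', IsConeDensity a φ' ∧ ∀ x, transferOp (s j) φ x = (1 - κ) * φ' x + κ)
    {φ ψ : S1 → ℝ} (hφ : IsConeDensity a φ) (hψ : IsConeDensity a ψ) (n : ℕ) :
    ∃ φ' ψ', IsConeDensity a φ' ∧ IsConeDensity a ψ' ∧
      ∀ x, pullback n s φ x - pullback n s ψ x = (1 - κ) ^ n * (φ' x - ψ' x) := by
  induction n generalizing s with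
  | zero => exact ⟨φ, ψ, hφ, hψ, fun x => by simp [pullback]⟩
  | succ n ih =>
    obtain ⟨φ', ψ', h1, h2, h3⟩ := ih (fun j => hs (j + 1)) (fun j => hκ (j + 1))
    obtain ⟨F, hF⟩ := hs 0
    obtain ⟨φ₁, hφ₁, e1⟩ := hκ 0 φ' h1
    obtain ⟨ψ₁, hψ₁, e2⟩ := hκ 0 ψ' h2
    refine ⟨φ₁, ψ₁, hφ₁, hψ₁, fun x => ?_⟩
    rw [RandomExpanding.pullback, RandomExpanding.pullback, ← congrFun (hF.transferOp_sub _ _) x,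
      funext h3, hF.transferOp_const_mul, hF.transferOp_sub]
    simp only [e1, e2]
    ring

end

/-- The sequence `A ρ^n` dominates the recurrence as soon as `α A + C ≤ ρ A`, hence the choice `A ≥
C / (ρ - α)`; the strict inequality `α < ρ` is essential. -/
theorem le_mul_pow_of_recurrence {α C ρ : ℝ} (hαρ : α < ρ) (hα : 0 ≤ α) {c₀ : ℝ} :
    ∃ A, 0 ≤ A ∧ c₀ ≤ A ∧ ∀ n : ℕ, α * (A * ρ ^ n) + C * ρ ^ n ≤ A * ρ ^ (n + 1) := by
  have hρ : 0 < ρ := hα.trans_lt hαρ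
  refine ⟨max |c₀| (C / (ρ - α)), le_max_of_le_left (abs_nonneg _),
    (le_abs_self _).trans (le_max_left _ _), fun n => ?_⟩
  set A := max |c₀| (C / (ρ - α))
  have h1 : C ≤ A * (ρ - α) := (div_le_iff₀ (sub_pos.2 hαρ)).1 (le_max_right _ _)
  have h2 := pow_pos hρ n
  rw [pow_succ]
  nlinarith

/-- Exponential decay, with all derivatives, of the increments of pullback products. -/
theorem exists_abs_circleD_pullback_le {N : ℕ} (hN : 1 ≤ N) {l : ℝ} (hl : 1 < l) (B : ℝ) :
    ∃ ρ, 0 < ρ ∧ ρ < 1 ∧ ∃ a, 0 ≤ a ∧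
      (∀ E, ExpClass N l B E → ∀ φ, IsConeDensity a φ → IsConeDensity a (transferOp E φ)) ∧
      ∀ r ≤ N, ∃ C, 0 ≤ C ∧ ∀ s : ℕ → S1 → S1, (∀ j, ExpClass N l B (s j)) →
        ∀ E, ExpClass N l B E → ∀ n x,
          |circleD^[r] (pullback n s fun y => 1 - transferOp E (fun _ => 1) y) x| ≤
            C * ρ ^ n * pullback n s (fun _ => 1) x := by
  obtain ⟨a, ha, hcone⟩ := exists_transferOp_isConeDensity hN hl B
  obtain ⟨κ, hκ0, hκ1, hκ⟩ := hcone a le_rfl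
  have hl' : l⁻¹ < 1 := inv_lt_one_of_one_lt₀ hl
  have hl0 : 0 < l⁻¹ := inv_pos.2 (by linarith)
  -- The rate must dominate `1 - κ`, for order zero, and strictly exceed `l⁻¹`, for the Lasota-Yorke
  -- recurrence at higher orders.
  obtain ⟨ρ, hρ, hρ1⟩ := exists_between (max_lt hl' (show 1 - κ < 1 by linarith))
  have hρl : l⁻¹ < ρ := (le_max_left _ _).trans_lt hρ
  have hρκ : 1 - κ < ρ := (le_max_right _ _).trans_lt hρ
  have hρ0 : 0 < ρ := hl0.trans hρl
  have hmaps : ∀ E, ExpClass N l B E → ∀ φ, IsConeDensity a φ → IsConeDensity a (transferOp E φ) :=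
    fun E hE φ hφ => (hκ E hE φ hφ).1
  refine ⟨ρ, hρ0, hρ1, a, ha, hmaps, fun r => ?_⟩
  have hone := IsConeDensity.one ha
  induction r using Nat.strong_induction_on with
  | _ r ih =>
  intro hr
  rcases r with _ | r
  · refine ⟨Real.exp a * Real.exp a, by positivity, fun s hs E hE n x => ?_⟩
    obtain ⟨φ', ψ', h1, h2, h3⟩ := exists_pullback_sub_eq (fun j => (hs j).exists_lift)
      (fun j φ hφ => (hκ (s j) (hs j) φ hφ).2) hone (hmaps E hE _ hone) n
    have hw := hone.pullback (C := {E | ExpClass N l B E}) hmaps hs n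
    rw [Function.iterate_zero, id, pullback_sub fun j => (hs j).exists_lift]
    simp only
    rw [h3 x, abs_mul, abs_of_nonneg (pow_nonneg (by linarith) n)]
    have e1 : (1 - κ) ^ n ≤ ρ ^ n := pow_le_pow_left₀ (by linarith) hρκ.le n
    have e2 := h1.abs_sub_le h2 ha x
    -- The lower bound on cone densities trades the constant `1` for the weight `pullback n s 1`,
    -- which the next operator transports exactly, without loss of a factor.
    have e3 : 1 ≤ Real.exp a * pullback n s (fun _ => 1) x := by
      have := mul_le_mul_of_nonneg_left (hw.exp_neg_le ha x) (Real.exp_pos a).le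
      rwa [← Real.exp_add, add_neg_cancel, Real.exp_zero] at this
    calc (1 - κ) ^ n * |φ' x - ψ' x| ≤ ρ ^ n * Real.exp a := by gcongr
      _ ≤ ρ ^ n * Real.exp a * (Real.exp a * pullback n s (fun _ => 1) x) :=
          le_mul_of_one_le_right (by positivity) e3
      _ = _ := by ring
  -- The induction hypothesis is made total in `j`, with junk constant `0` for `j > r`, so that
  -- constants can be chosen.
  · have ih' : ∀ j : ℕ, ∃ C, 0 ≤ C ∧ (j < r + 1 → ∀ s : ℕ → S1 → S1, (∀ j, ExpClass N l B (s j)) →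
        ∀ E, ExpClass N l B E → ∀ n x,
          |circleD^[j] (pullback n s fun y => 1 - transferOp E (fun _ => 1) y) x| ≤
            C * ρ ^ n * pullback n s (fun _ => 1) x) := fun j => by
      by_cases hj : j < r + 1
      · obtain ⟨C, hC0, hC⟩ := ih j hj (hj.le.trans hr)
        exact ⟨C, hC0, fun _ => hC⟩
      · exact ⟨0, le_rfl, fun h => absurd h hj⟩
    choose c hc0 hc using ih'
    obtain ⟨L, hL0, hL⟩ := exists_lasotaYorke N hl B r hr
    obtain ⟨A, hA0, hA1, hA⟩ := le_mul_pow_of_recurrence hρl hl0.le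
      (C := L * ∑ j ∈ Finset.range (r + 1), c j) (c₀ := L * Real.exp a + l⁻¹)
    refine ⟨A, hA0, fun s hs E hE n => ?_⟩
    have hsm : IsSmoothCircleFun fun y => 1 - transferOp E (fun _ => 1) y :=
      (IsSmoothCircleFun.const 1).sub (hmaps E hE _ hone).smooth
    induction n generalizing s with
    | zero =>
      intro x
      simp only [pullback, pow_zero, mul_one]
      rw [iterate_circleD_sub (.const 1) (hmaps E hE _ hone).smooth]
      have hone' : ∀ j (x : S1), circleD^[j + 1] (fun _ => (1 : ℝ)) x = 0 := by
        intro j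
        rw [Function.iterate_succ_apply, circleD_const]
        induction j with
        | zero => exact fun _ => rfl
        | succ j ihj => rwa [Function.iterate_succ_apply, circleD_const]
      simp only
      rw [hone', zero_sub, abs_neg]
      -- Lasota-Yorke for `φ = w = 1`: only the bound of order zero is nonzero.
      have h1 := hL E hE _ (.const 1) (fun _ => 1) (fun j => if j = 0 then 1 else 0)
        (fun _ => zero_le_one) (fun j _ x => by
          rcases j with _ | j
          · simp
          · rw [hone']; simp) x
      refine h1.trans (le_trans ?_ hA1)
      simp only [Finset.sum_ite_eq', Finset.mem_range, Nat.succ_pos, if_true,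
        Nat.succ_ne_zero, if_false, mul_zero, zero_add, mul_one]
      have := mul_le_mul_of_nonneg_left ((hmaps E hE _ hone).le_exp ha x) hL0
      linarith
    | succ n ihn =>
      intro x
      have hs' : ∀ j, ExpClass N l B (s (j + 1)) := fun j => hs (j + 1)
      have hsm' := hsm.pullback (fun j => (hs' j).exists_lift) n
      have hw := hone.pullback (C := {E | ExpClass N l B E}) hmaps hs' n
      -- Orders at most `r` are controlled by the outer induction, the top order `r + 1` by the
      -- inner induction on `n`, both relative to the same weight.
      have h1 := hL (s 0) (hs 0) _ hsm' (pullback n (fun j => s (j + 1)) fun _ => 1)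
        (fun j => if j = r + 1 then A * ρ ^ n else c j * ρ ^ n) hw.nonneg (fun j hj x => by
          rcases hj.lt_or_eq with hj | hj
          · simp only [if_neg hj.ne]
            exact hc j hj _ hs' E hE n x
          · simp only [if_pos hj]
            rw [hj]
            exact ihn _ hs' x) x
      refine h1.trans ?_
      obtain ⟨F, hF⟩ := (hs 0).exists_lift
      refine mul_le_mul_of_nonneg_right ?_ (hF.transferOp_nonneg hw.nonneg x)
      refine le_trans ?_ (hA n)
      rw [if_pos rfl, mul_assoc, Finset.sum_mul]
      refine add_le_add le_rfl (mul_le_mul_of_nonneg_left (Finset.sum_le_sum fun j hj => ?_) hL0)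
      rw [if_neg (Finset.mem_range.1 hj).ne]

/-! ### Equivariant densities of sequences of expanding maps -/

/-- The circle maps `s j` are uniformly expanding, with uniformly bounded derivatives. -/
def ExpSeq (l : ℝ) (s : ℕ → S1 → S1) : Prop := ∀ N, ∃ B, ∀ j, ExpClass N l B (s j)

/-- The limit of the densities `M_{s 0} ∘ ⋯ ∘ M_{s (n - 1)} 1`. -/
noncomputable def pullbackDensity (s : ℕ → S1 → S1) (x : S1) : ℝ :=
  1 - ∑' n, pullback n s (fun y => 1 - transferOp (s n) (fun _ => 1) y) x

/-- The weighted estimate with `E = s n`, the weight being at most `e^a`. -/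
theorem exists_abs_circleD_increment_le {N : ℕ} (hN : 1 ≤ N) {l : ℝ} (hl : 1 < l) (B : ℝ) :
    ∃ ρ, 0 < ρ ∧ ρ < 1 ∧ ∀ r ≤ N, ∃ C, 0 ≤ C ∧ ∀ s : ℕ → S1 → S1, (∀ j, ExpClass N l B (s j)) →
      ∀ n x, |circleD^[r] (pullback n s fun y => 1 - transferOp (s n) (fun _ => 1) y) x| ≤
        C * ρ ^ n := by
  obtain ⟨ρ, h0, h1, a, ha, hmaps, h⟩ := exists_abs_circleD_pullback_le hN hl B
  refine ⟨ρ, h0, h1, fun r hr => ?_⟩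
  obtain ⟨C, hC0, hC⟩ := h r hr
  refine ⟨C * Real.exp a, by positivity, fun s hs n x => (hC s hs _ (hs n) n x).trans ?_⟩
  have hw := (IsConeDensity.one ha).pullback (C := {E | ExpClass N l B E}) hmaps hs n
  calc C * ρ ^ n * pullback n s (fun _ => 1) x ≤ C * ρ ^ n * Real.exp a := by
        gcongr; exact hw.le_exp ha x
    _ = _ := by ring

/-- Telescoping identifies the series in `pullbackDensity` with the limit of pullbacks of `1`; the
series form is the one that can be differentiated term by term. -/
theorem sum_increment (s : ℕ → S1 → S1) (hs : ∀ j, ∃ F, IsExpandingLift (s j) F) (n : ℕ) (x : S1) :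
    ∑ i ∈ Finset.range n, pullback i s (fun y => 1 - transferOp (s i) (fun _ => 1) y) x =
      1 - pullback n s (fun _ => 1) x := by
  induction n with
  | zero => simp [pullback]
  | succ n ih =>
    rw [Finset.sum_range_succ, ih, pullback_succ', pullback_sub hs]
    simp only
    ring

/-- The error is the tail of the telescoping series, geometrically small at a rate depending only on
the class. -/
theorem exists_abs_pullbackDensity_sub_le {l : ℝ} (hl : 1 < l) (B : ℝ) :
    ∃ ρ C, 0 < ρ ∧ ρ < 1 ∧ 0 ≤ C ∧ ∀ s : ℕ → S1 → S1, (∀ j, ExpClass 1 l B (s j)) → ∀ n x,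
      |pullback n s (fun _ => 1) x - pullbackDensity s x| ≤ C * ρ ^ n := by
  obtain ⟨ρ, h0, h1, h⟩ := exists_abs_circleD_increment_le le_rfl hl B
  obtain ⟨C, hC0, hC⟩ := h 0 zero_le_one
  have h1' : 0 < 1 - ρ := by linarith
  refine ⟨ρ, C / (1 - ρ), h0, h1, by positivity, fun s hs n x => ?_⟩
  have hb : ∀ i, ‖pullback i s (fun y => 1 - transferOp (s i) (fun _ => 1) y) x‖ ≤ C * ρ ^ i :=
    fun i => hC s hs i x
  have hsum := (summable_geometric_of_lt_one h0.le h1).mul_left C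
  have hs1 : Summable fun i => pullback i s (fun y => 1 - transferOp (s i) (fun _ => 1) y) x :=
    Summable.of_norm_bounded hsum hb
  have h2 := hs1.sum_add_tsum_nat_add n
  rw [sum_increment s fun j => (hs j).exists_lift] at h2
  have h3 : pullback n s (fun _ => 1) x - pullbackDensity s x =
      ∑' i, pullback (i + n) s (fun y => 1 - transferOp (s (i + n)) (fun _ => 1) y) x := by
    rw [pullbackDensity]; linarith
  have h4 : HasSum (fun i => C * ρ ^ (i + n)) (C / (1 - ρ) * ρ ^ n) := by
    have := (hasSum_geometric_of_lt_one h0.le h1).mul_left (C * ρ ^ n)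
    rw [show C / (1 - ρ) * ρ ^ n = C * ρ ^ n * (1 - ρ)⁻¹ by rw [div_eq_mul_inv]; ring]
    simpa only [pow_add, mul_assoc, mul_comm (ρ ^ n)] using this
  rw [h3]
  exact tsum_of_norm_bounded h4 fun i => hb (i + n)

theorem tendsto_pullbackDensity {l B : ℝ} (hl : 1 < l) {s : ℕ → S1 → S1}
    (hs : ∀ j, ExpClass 1 l B (s j)) (x : S1) :
    Tendsto (fun n => pullback n s (fun _ => 1) x) atTop (𝓝 (pullbackDensity s x)) := by
  obtain ⟨ρ, C, h0, h1, -, h⟩ := exists_abs_pullbackDensity_sub_le hl B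
  rw [tendsto_iff_norm_sub_tendsto_zero]
  refine squeeze_zero (fun _ => norm_nonneg _) (fun n => h s hs n x) ?_
  simpa using (tendsto_pow_atTop_nhds_zero_of_lt_one h0.le h1).const_mul C

/-- The transfer operator of `s 0` maps the density of the shifted sequence to that of `s`. -/
theorem transferOp_pullbackDensity {l B : ℝ} (hl : 1 < l) {s : ℕ → S1 → S1}
    (hs : ∀ j, ExpClass 1 l B (s j)) :
    transferOp (s 0) (pullbackDensity fun j => s (j + 1)) = pullbackDensity s := by
  funext x
  obtain ⟨F, hF⟩ := (hs 0).exists_lift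
  refine tendsto_nhds_unique (f := fun n => pullback (n + 1) s (fun _ => 1) x) ?_
    ((tendsto_pullbackDensity hl hs x).comp (tendsto_add_atTop_nat 1))
  simp only [pullback, transferOp, finsum_mem_eq_finite_toFinset_sum _ (hF.finite_fibre x)]
  exact tendsto_finsetSum _ fun y _ =>
    (tendsto_pullbackDensity hl (fun j => hs (j + 1)) y).div_const _

section

variable {l : ℝ} {s : ℕ → S1 → S1}

theorem ExpSeq.summable_bounds (hl : 1 < l) (hs : ExpSeq l s) (r : ℕ) :
    ∃ v : ℕ → ℝ, Summable v ∧ ∀ n x,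
      |circleD^[r] (pullback n s fun y => 1 - transferOp (s n) (fun _ => 1) y) x| ≤ v n := by
  obtain ⟨B, hB⟩ := hs (r + 1)
  obtain ⟨ρ, h0, h1, h⟩ := exists_abs_circleD_increment_le (Nat.succ_pos r) hl B
  obtain ⟨C, -, hC⟩ := h r r.le_succ
  exact ⟨_, (summable_geometric_of_lt_one h0.le h1).mul_left C, fun n x => hC s hB n x⟩

theorem isSmoothCircleFun_increment (hs : ∀ j, ∃ F, IsExpandingLift (s j) F) (n : ℕ) :
    IsSmoothCircleFun (pullback n s fun y => 1 - transferOp (s n) (fun _ => 1) y) :=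
  let ⟨_, hF⟩ := hs n
  ((IsSmoothCircleFun.const 1).sub (hF.isSmoothCircleFun_transferOp (.const 1))).pullback hs n

theorem ExpSeq.exists_lift (hs : ExpSeq l s) (j : ℕ) : ∃ F, IsExpandingLift (s j) F :=
  let ⟨_, hB⟩ := hs 0
  (hB j).exists_lift

theorem norm_iteratedFDeriv_eq_abs (φ : S1 → ℝ) (r : ℕ) (t : ℝ) :
    ‖iteratedFDeriv ℝ r (fun t : ℝ => φ (t : S1)) t‖ = |circleD^[r] φ t| := by
  rw [norm_iteratedFDeriv_eq_norm_iteratedDeriv, iterate_circleD_coe, Real.norm_eq_abs]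

theorem ExpSeq.isSmoothCircleFun (hl : 1 < l) (hs : ExpSeq l s) :
    IsSmoothCircleFun (fun x => ∑' n, pullback n s (fun y => 1 - transferOp (s n) (fun _ => 1) y) x)
      := by
  choose v hv hb using fun r => hs.summable_bounds hl r
  refine contDiff_tsum (N := ⊤) (v := v) (fun n => isSmoothCircleFun_increment hs.exists_lift n)
    (fun k _ => hv k) fun k n t _ => ?_
  rw [norm_iteratedFDeriv_eq_abs]
  exact hb k n t

theorem ExpSeq.isSmoothCircleFun_pullbackDensity (hl : 1 < l) (hs : ExpSeq l s) :
    IsSmoothCircleFun (pullbackDensity s) :=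
  (IsSmoothCircleFun.const 1).sub (hs.isSmoothCircleFun hl)

end

/-- The derivatives of the limit densities are bounded on expanding classes. -/
theorem exists_abs_circleD_pullbackDensity_le (r : ℕ) {l : ℝ} (hl : 1 < l) (B : ℝ) :
    ∃ K, ∀ s : ℕ → S1 → S1, ExpSeq l s → (∀ j, ExpClass (r + 1) l B (s j)) → ∀ x,
      |circleD^[r] (pullbackDensity s) x| ≤ K := by
  obtain ⟨ρ, h0, h1, h⟩ := exists_abs_circleD_increment_le (Nat.succ_pos r) hl B
  obtain ⟨C, -, hC⟩ := h r r.le_succ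
  have hone : ∃ K, ∀ x : S1, |circleD^[r] (fun _ => (1 : ℝ)) x| ≤ K := by
    obtain ⟨K, hK⟩ := UnifBdd.const (ι := Unit) (n := r) 1 r le_rfl
    exact ⟨K, hK ()⟩
  obtain ⟨K, hK⟩ := hone
  have hgeom := (hasSum_geometric_of_lt_one h0.le h1).mul_left C
  refine ⟨K + C * (1 - ρ)⁻¹, fun s hs hB => forall_circle fun t => ?_⟩
  have hdef : pullbackDensity s = fun x => (fun _ => (1 : ℝ)) x -
    (fun x => ∑' n, pullback n s (fun y => 1 - transferOp (s n) (fun _ => 1) y) x) x := rfl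
  rw [hdef, iterate_circleD_sub (.const 1) (hs.isSmoothCircleFun hl)]
  refine (abs_sub _ _).trans (add_le_add (hK t) ?_)
  -- The majorants `v` depend on `s` and only justify termwise differentiation; the uniform bound
  -- comes from `hgeom`.
  choose v hv hb using fun r => hs.summable_bounds hl r
  rw [← norm_iteratedFDeriv_eq_abs, iteratedFDeriv_tsum (N := ⊤) (v := v)
    (fun n => isSmoothCircleFun_increment hs.exists_lift n) (fun k _ => hv k)
    (fun k n t _ => by rw [norm_iteratedFDeriv_eq_abs]; exact hb k n t) le_top]
  exact tsum_of_norm_bounded hgeom fun n => by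
    rw [norm_iteratedFDeriv_eq_abs]
    exact hC s hB n t

theorem ExpSeq.integral_pullbackDensity {l : ℝ} {s : ℕ → S1 → S1} (hl : 1 < l) (hs : ExpSeq l s) :
    ∫ x, pullbackDensity s x = 1 := by
  obtain ⟨B, hB⟩ := hs 1
  obtain ⟨ρ, C, h0, h1, -, h⟩ := exists_abs_pullbackDensity_sub_le hl B
  obtain ⟨a, ha, hcone⟩ := exists_transferOp_isConeDensity le_rfl hl B
  obtain ⟨κ, -, -, hκ⟩ := hcone a le_rfl
  have hw := fun n => (IsConeDensity.one ha).pullback (C := {E | ExpClass 1 l B E})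
    (fun E hE φ hφ => (hκ E hE φ hφ).1) hB n
  have hint := (hs.isSmoothCircleFun_pullbackDensity hl).continuous.integrable_circle
  have hle : ∀ n, |1 - ∫ x, pullbackDensity s x| ≤ C * ρ ^ n := fun n => by
    have e : 1 - ∫ x, pullbackDensity s x =
        ∫ x, (pullback n s (fun _ => 1) x - pullbackDensity s x) := by
      rw [integral_sub (hw n).smooth.continuous.integrable_circle hint, (hw n).integral_eq_one]
    rw [e]
    have := norm_integral_le_of_norm_le_const (μ := (volume : Measure S1))
      (f := fun x => pullback n s (fun _ => 1) x - pullbackDensity s x)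
      (Eventually.of_forall fun x => h s hB n x)
    simpa using this
  have hlim : Tendsto (fun n => C * ρ ^ n) atTop (𝓝 0) := by
    simpa using (tendsto_pow_atTop_nhds_zero_of_lt_one h0.le h1).const_mul C
  have := abs_nonpos_iff.1 (ge_of_tendsto' hlim hle)
  linarith

theorem ExpSeq.pullbackDensity_pos {l : ℝ} {s : ℕ → S1 → S1} (hl : 1 < l) (hs : ExpSeq l s)
    (x : S1) : 0 < pullbackDensity s x := by
  obtain ⟨B, hB⟩ := hs 1
  obtain ⟨a, ha, hcone⟩ := exists_transferOp_isConeDensity le_rfl hl B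
  obtain ⟨κ, -, -, hκ⟩ := hcone a le_rfl
  have hw := fun n => (IsConeDensity.one ha).pullback (C := {E | ExpClass 1 l B E})
    (fun E hE φ hφ => (hκ E hE φ hφ).1) hB n
  exact (Real.exp_pos (-a)).trans_le
    (ge_of_tendsto' (tendsto_pullbackDensity hl hB x) fun n => (hw n).exp_neg_le ha x)

/-! ### Stability in `L¹` -/

theorem IsExpandingLift.integral_abs_transferOp_le {E : S1 → S1} {F : ℝ → ℝ}
    (h : IsExpandingLift E F) {φ : S1 → ℝ} (hφ : Continuous φ) :
    ∫ x, |transferOp E φ x| ≤ ∫ x, |φ x| := by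
  rw [← h.integral_transferOp hφ.abs]
  exact integral_mono (h.continuous_transferOp hφ).abs.integrable_circle
    (h.continuous_transferOp hφ.abs).integrable_circle (h.abs_transferOp_le fun x => le_rfl)

theorem IsSmoothCircleFun.abs_sub_le_dist {φ : S1 → ℝ} (hφ : IsSmoothCircleFun φ) {L : ℝ}
    (hL : ∀ x, |RandomExpanding.circleD φ x| ≤ L) (x y : S1) : |φ x - φ y| ≤ L * dist x y := by
  induction x using QuotientAddGroup.induction_on with
  | H s =>
    induction y using QuotientAddGroup.induction_on with
    | H t =>
      -- Translating `t` by the integer nearest to `s - t` realizes the circle distance as a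
      -- distance on the line.
      have h1 : dist (s : S1) (t : S1) = |s - (t + round (s - t))| := by
        rw [dist_eq_norm, ← AddCircle.coe_sub, UnitAddCircle.norm_eq, sub_sub]
      have h2 : (t : S1) = ((t + round (s - t) : ℝ) : S1) :=
        coe_eq_coe_iff.2 ⟨-round (s - t), by push_cast; ring⟩
      rw [show dist (QuotientAddGroup.mk s : S1) (QuotientAddGroup.mk t : S1) = _ from h1,
        show φ (QuotientAddGroup.mk t) = φ ((t + round (s - t) : ℝ) : S1) from congrArg φ h2]
      have := convex_univ.norm_image_sub_le_of_norm_hasDerivWithin_le (s := Set.univ)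
        (f := fun t : ℝ => φ (t : S1)) (C := L)
        (fun t _ => (hφ.hasDerivAt t).hasDerivWithinAt) (fun t _ => hL t)
        (Set.mem_univ (t + round (s - t) : ℝ)) (Set.mem_univ s)
      simpa [Real.norm_eq_abs] using this

/-- Transfer operators of `C⁰`-close maps are close in the weak sense needed for densities. -/
theorem integral_abs_transferOp_sub_le {E E₀ : S1 → S1} {F F₀ : ℝ → ℝ} (h : IsExpandingLift E F)
    (h₀ : IsExpandingLift E₀ F₀) {a : ℝ} (ha : 0 ≤ a) {φ : S1 → ℝ} (hφ : IsConeDensity a φ)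
    (h1 : IsConeDensity a (transferOp E φ)) (h2 : IsConeDensity a (transferOp E₀ φ)) {η : ℝ}
    (hη : 0 < η) (hd : ∀ x, 2 * a * Real.exp a * dist (E x) (E₀ x) ≤ η ^ 2) :
    ∫ x, |transferOp E φ x - transferOp E₀ φ x| ≤ η := by
  set u : S1 → ℝ := fun x => transferOp E φ x - transferOp E₀ φ x with hu
  have hus : IsSmoothCircleFun u := h1.smooth.sub h2.smooth
  have huc := hus.continuous
  have hEc := h.continuous
  have hE₀c := h₀.continuous
  have hφc := hφ.smooth.continuous
  have hL : ∀ x, |circleD u x| ≤ 2 * a * Real.exp a := fun x => by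
    rw [hu, h1.smooth.circleD_sub h2.smooth]
    have e1 := (h1.abs_circleD_le x).trans (mul_le_mul_of_nonneg_left (h1.le_exp ha x) ha)
    have e2 := (h2.abs_circleD_le x).trans (mul_le_mul_of_nonneg_left (h2.le_exp ha x) ha)
    refine (abs_sub _ _).trans ?_
    linarith
  have hsq : ∫ x, u x ^ 2 ≤ η ^ 2 := by
    -- One factor `u` serves as test function: duality moves the difference of operators to a
    -- difference of the points `E x` and `E₀ x`, where `u` is Lipschitz.
    have e1 : ∫ x, u x ^ 2 = ∫ x, φ x * (u (E x) - u (E₀ x)) := by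
      have e2 : ∀ x, u x ^ 2 = transferOp E φ x * u x - transferOp E₀ φ x * u x := fun x => by
        simp only [hu]; ring
      have hc1 := h1.smooth.continuous
      have hc2 := h2.smooth.continuous
      simp only [e2, mul_sub]
      rw [integral_sub (Continuous.integrable_circle (by fun_prop))
        (Continuous.integrable_circle (by fun_prop)),
        integral_sub (Continuous.integrable_circle (by fun_prop))
        (Continuous.integrable_circle (by fun_prop)),
        h.integral_transferOp_mul hφc huc, h₀.integral_transferOp_mul hφc huc]
    calc ∫ x, u x ^ 2 = ∫ x, φ x * (u (E x) - u (E₀ x)) := e1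
      _ ≤ ∫ x, φ x * η ^ 2 := integral_mono (Continuous.integrable_circle (by fun_prop))
          (Continuous.integrable_circle (by fun_prop)) fun x =>
            mul_le_mul_of_nonneg_left ((le_abs_self _).trans
              ((hus.abs_sub_le_dist hL _ _).trans (hd x))) (hφ.nonneg x)
      _ = η ^ 2 := by rw [integral_mul_const, hφ.integral_eq_one, one_mul]
  -- The inequality `2 η |u| ≤ u² + η²` passes from `L²` to `L¹`.
  calc ∫ x, |u x| ≤ ∫ x, (u x ^ 2 * (2 * η)⁻¹ + η / 2) := by
        refine integral_mono (Continuous.integrable_circle (by fun_prop))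
          (Continuous.integrable_circle (by fun_prop)) fun x => ?_
        have e := sq_nonneg (|u x| - η)
        rw [sub_sq, sq_abs] at e
        show |u x| ≤ u x ^ 2 * (2 * η)⁻¹ + η / 2
        have : u x ^ 2 * (2 * η)⁻¹ + η / 2 = (u x ^ 2 + η ^ 2) / (2 * η) := by field_simp
        rw [this, le_div_iff₀ (by positivity)]
        linarith
    _ = (∫ x, u x ^ 2) * (2 * η)⁻¹ + η / 2 := by
        rw [integral_add (Continuous.integrable_circle (by fun_prop)) (integrable_const _),
          integral_mul_const]
        simp
    _ ≤ η ^ 2 * (2 * η)⁻¹ + η / 2 := by gcongr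
    _ = η := by field_simp; ring

/-- Transfer operators do not increase the `L¹` norm, so the one-step errors simply add up. -/
theorem integral_abs_pullback_sub_le {φ : S1 → ℝ} (hφ : IsSmoothCircleFun φ) {η : ℝ}
    {s : ℕ → S1 → S1} (hs : ∀ j, ∃ F, IsExpandingLift (s j) F)
    (h : ∀ j, ∫ x, |transferOp (s j) φ x - φ x| ≤ η) (n : ℕ) :
    ∫ x, |pullback n s φ x - φ x| ≤ n * η := by
  induction n generalizing s with
  | zero => simp [pullback]
  | succ n ih =>
    obtain ⟨F, hF⟩ := hs 0
    have ih := ih (fun j => hs (j + 1)) (fun j => h (j + 1))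
    have hp := (hφ.pullback (fun j => hs (j + 1)) n)
    have hc : Continuous fun x => pullback n (fun j => s (j + 1)) φ x - φ x :=
      (hp.sub hφ).continuous
    have hm : Continuous (transferOp (s 0) φ) := hF.continuous_transferOp hφ.continuous
    have hφc := hφ.continuous
    have h1 := hF.integral_abs_transferOp_le hc
    have hmc := hF.continuous_transferOp hc
    have e : ∀ x, |pullback (n + 1) s φ x - φ x| ≤
        |transferOp (s 0) (fun x => pullback n (fun j => s (j + 1)) φ x - φ x) x| +
          |transferOp (s 0) φ x - φ x| := fun x => by
      rw [hF.transferOp_sub, pullback]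
      simpa using abs_add_le (transferOp (s 0) (pullback n (fun j => s (j + 1)) φ) x -
        transferOp (s 0) φ x) (transferOp (s 0) φ x - φ x)
    have h2 := integral_mono ((hφ.pullback hs (n + 1)).sub hφ).continuous.abs.integrable_circle
      (Continuous.integrable_circle (by fun_prop)) e
    rw [integral_add (Continuous.integrable_circle (by fun_prop))
      (Continuous.integrable_circle (by fun_prop))] at h2
    have := h 0
    push_cast
    linarith

/-- The limit densities depend continuously, in `L¹`, on the maps in an expanding class. -/
theorem exists_integral_abs_pullbackDensity_sub_le {l : ℝ} (hl : 1 < l) (B : ℝ) {E₀ : S1 → S1}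
    (hE₀ : ExpSeq l fun _ => E₀) (hB : ExpClass 1 l B E₀) {η : ℝ} (hη : 0 < η) :
    ∃ δ > 0, ∀ s : ℕ → S1 → S1, ExpSeq l s → (∀ j, ExpClass 1 l B (s j)) →
      (∀ j x, dist (s j x) (E₀ x) ≤ δ) →
        ∫ x, |pullbackDensity s x - pullbackDensity (fun _ => E₀) x| ≤ η := by
  set h₀ := pullbackDensity (fun _ => E₀) with hh₀
  have hsm := hE₀.isSmoothCircleFun_pullbackDensity hl
  obtain ⟨b, hb⟩ := exists_isConeDensity hsm (hE₀.pullbackDensity_pos hl)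
    (hE₀.integral_pullbackDensity hl)
  obtain ⟨a₀, ha₀, hcone⟩ := exists_transferOp_isConeDensity le_rfl hl B
  -- The slope is enlarged so that the cone also contains `h₀`.
  set a := max a₀ b
  have ha : 0 ≤ a := ha₀.trans (le_max_left _ _)
  have hh : IsConeDensity a h₀ := hb a (le_max_right _ _)
  obtain ⟨κ, hκ0, hκ1, hκ⟩ := hcone a (le_max_left _ _)
  obtain ⟨ρ, C, hρ0, hρ1, hC0, hC⟩ := exists_abs_pullbackDensity_sub_le hl B
  -- The number of steps `n` is fixed first, by memory loss uniform over the class; only then is `δ`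
  -- chosen, with error `η'` per step and `n η' ≤ η / 2`.
  have hlim : Tendsto (fun n : ℕ => C * ρ ^ n + (1 - κ) ^ n * Real.exp a) atTop (𝓝 0) := by
    simpa using ((tendsto_pow_atTop_nhds_zero_of_lt_one hρ0.le hρ1).const_mul C).add
      ((tendsto_pow_atTop_nhds_zero_of_lt_one (by linarith : 0 ≤ 1 - κ)
        (by linarith)).mul_const (Real.exp a))
  obtain ⟨n, hn⟩ := (hlim.eventually (gt_mem_nhds (half_pos hη))).exists
  set η' := η / 2 / (n + 1) with hη'
  have hη0 : 0 < η' := by positivity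
  have hLpos : 0 < 2 * a * Real.exp a + 1 := by positivity
  refine ⟨η' ^ 2 / (2 * a * Real.exp a + 1), by positivity, fun s hs hsB hd => ?_⟩
  obtain ⟨F₀, hF₀⟩ := hB.exists_lift
  have hfix : transferOp E₀ h₀ = h₀ := transferOp_pullbackDensity hl (s := fun _ => E₀) fun _ => hB
  have hstep : ∀ j, ∫ x, |transferOp (s j) h₀ x - h₀ x| ≤ η' := fun j => by
    obtain ⟨F, hF⟩ := (hsB j).exists_lift
    have := integral_abs_transferOp_sub_le hF hF₀ ha hh (hκ _ (hsB j) _ hh).1 (hκ _ hB _ hh).1 hη0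
      fun x => by
        have h1 := (le_div_iff₀ hLpos).1 (hd j x)
        nlinarith [dist_nonneg (x := s j x) (y := E₀ x)]
    rwa [hfix] at this
  have h1 := integral_abs_pullback_sub_le hh.smooth hs.exists_lift hstep n
  obtain ⟨φ', ψ', hφ', hψ', hsub⟩ := exists_pullback_sub_eq hs.exists_lift
    (fun j φ hφ => (hκ _ (hsB j) φ hφ).2) (IsConeDensity.one ha) hh n
  -- Triangle inequality through the pullbacks of `1` and of `h₀`.
  have hle : ∀ x, |pullbackDensity s x - h₀ x| ≤
      (C * ρ ^ n + (1 - κ) ^ n * Real.exp a) + |pullback n s h₀ x - h₀ x| := fun x => by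
    have e1 := hC s hsB n x
    rw [abs_sub_comm] at e1
    have e2 : |pullback n s (fun _ => 1) x - pullback n s h₀ x| ≤ (1 - κ) ^ n * Real.exp a := by
      rw [hsub, abs_mul, abs_of_nonneg (pow_nonneg (by linarith) n)]
      exact mul_le_mul_of_nonneg_left (hφ'.abs_sub_le hψ' ha x) (pow_nonneg (by linarith) n)
    have e3 := abs_sub_le (pullbackDensity s x) (pullback n s (fun _ => 1) x) (h₀ x)
    have e4 := abs_sub_le (pullback n s (fun _ => 1) x) (pullback n s h₀ x) (h₀ x)
    linarith
  have hpc : Continuous fun x => |pullback n s h₀ x - h₀ x| :=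
    ((hh.smooth.pullback hs.exists_lift n).sub hh.smooth).continuous.abs
  have h2 := integral_mono
    ((hs.isSmoothCircleFun_pullbackDensity hl).sub hsm).continuous.abs.integrable_circle
    ((integrable_const _).add hpc.integrable_circle) hle
  have h3 : ∫ x, ((C * ρ ^ n + (1 - κ) ^ n * Real.exp a) + |pullback n s h₀ x - h₀ x|) =
      (C * ρ ^ n + (1 - κ) ^ n * Real.exp a) + ∫ x, |pullback n s h₀ x - h₀ x| := by
    rw [integral_add (integrable_const _) hpc.integrable_circle]
    simp
  have h4 : n * η' ≤ η / 2 := by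
    rw [hη', mul_div_assoc', div_le_iff₀ (by positivity)]
    nlinarith
  refine h2.trans ?_
  simp only [Pi.add_apply]
  linarith

/-! ### Sobolev norms -/

theorem volume_circle_eq_haar : (volume : Measure S1) = AddCircle.haarAddCircle := by
  rw [AddCircle.volume_eq_smul_haarAddCircle, ENNReal.ofReal_one, one_smul]

theorem norm_fourierCoeff_le (u : S1 → ℝ) (n : ℤ) :
    ‖fourierCoeff (fun x => (u x : ℂ)) n‖ ≤ ∫ x, |u x| := by
  rw [fourierCoeff, ← volume_circle_eq_haar]
  refine (norm_integral_le_integral_norm _).trans_eq ?_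
  refine integral_congr_ae (Eventually.of_forall fun x => ?_)
  simp only [norm_smul, Complex.norm_real, Real.norm_eq_abs, fourier_apply, Circle.norm_coe,
    one_mul]

theorem fourierCoeff_circleD {u : S1 → ℝ} (hu : IsSmoothCircleFun u) (n : ℤ) :
    fourierCoeff (fun x => (circleD u x : ℂ)) n =
      2 * Real.pi * Complex.I * n * fourierCoeff (fun x => (u x : ℂ)) n := by
  rw [fourierCoeff_eq_intervalIntegral _ n 0, fourierCoeff_eq_intervalIntegral _ n 0]
  simp only [zero_add, smul_eq_mul, div_one, one_smul]
  have h1 := intervalIntegral.integral_mul_deriv_eq_deriv_mul (a := 0) (b := 1)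
    (u := fun t : ℝ => fourier (-n) (t : S1)) (v := fun t : ℝ => ((u (t : S1) : ℝ) : ℂ))
    (u' := fun t : ℝ => -2 * Real.pi * Complex.I * n / (1 : ℝ) * fourier (-n) (t : S1))
    (v' := fun t : ℝ => ((circleD u (t : S1) : ℝ) : ℂ))
    (fun t _ => hasDerivAt_fourier_neg 1 n t)
    (fun t _ => (hu.hasDerivAt t).ofReal_comp) ?_ ?_
  · rw [h1]
    -- The boundary terms cancel by periodicity.
    have h2 : ((1 : ℝ) : S1) = ((0 : ℝ) : S1) := coe_eq_coe_iff.2 ⟨1, by simp⟩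
    rw [h2, sub_self, zero_sub, ← intervalIntegral.integral_neg,
      ← intervalIntegral.integral_const_mul]
    refine intervalIntegral.integral_congr fun t _ => ?_
    simp only [Complex.ofReal_one, div_one]
    ring
  · have : Continuous ((↑) : ℝ → S1) := AddCircle.continuous_mk' 1
    exact Continuous.intervalIntegrable (by fun_prop) _ _
  · have h3 := ContDiff.continuous hu.circleD
    exact Continuous.intervalIntegrable (by fun_prop) _ _

theorem norm_fourierCoeff_iterate_circleD {u : S1 → ℝ} (hu : IsSmoothCircleFun u) (n : ℤ) (r : ℕ) :
    ‖fourierCoeff (fun x => (circleD^[r] u x : ℂ)) n‖ =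
      |2 * Real.pi * n| ^ r * ‖fourierCoeff (fun x => (u x : ℂ)) n‖ := by
  induction r with
  | zero => simp
  | succ r ih =>
    simp only [Function.iterate_succ_apply']
    rw [fourierCoeff_circleD (hu.iterate_circleD r), norm_mul, ih]
    have : ‖(2 * Real.pi * Complex.I * n : ℂ)‖ = |2 * Real.pi * n| := by
      simp [abs_mul]
    rw [this, pow_succ]
    ring

/-- Interpolation: Sobolev norms are controlled by the `L¹` norm and `C^r` bounds. -/
theorem exists_sobolevNorm_le (m : ℕ) (K : ℝ) : ∃ A : ℝ, ∀ u : S1 → ℝ, IsSmoothCircleFun u →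
    (∀ x, |u x| ≤ K) → (∀ x, |circleD^[2 * (m + 1)] u x| ≤ K) →
      sobolevNorm m u ≤ ENNReal.ofReal (A * ∫ x, |u x|) ^ (1 / 2 : ℝ) := by
  have hsum : Summable fun n : ℤ => (1 + (2 * Real.pi * n) ^ 2)⁻¹ := by
    have h1 : Summable fun n : ℤ => (1 : ℝ) / (n : ℝ) ^ 2 :=
      Real.summable_one_div_int_pow.2 one_lt_two
    refine Summable.of_norm_bounded_eventually h1 ?_
    filter_upwards [(Set.finite_singleton (0 : ℤ)).compl_mem_cofinite] with n hn
    have hn0 : (n : ℝ) ≠ 0 := by simpa using hn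
    have hn1 : 0 < (n : ℝ) ^ 2 := by positivity
    rw [Real.norm_of_nonneg (by positivity), one_div]
    refine inv_anti₀ hn1 ?_
    have h3 : 1 ≤ (2 * Real.pi) ^ 2 := one_le_pow₀ (by linarith [Real.pi_gt_three])
    rw [mul_pow]
    nlinarith
  set S := ∑' n : ℤ, (1 + (2 * Real.pi * n) ^ 2)⁻¹ with hS
  refine ⟨2 ^ (m + 1) * (2 * K) * S, fun u hu hK hK' => ?_⟩
  refine ENNReal.rpow_le_rpow ?_ (by norm_num)
  have hint : ∀ {v : S1 → ℝ}, (∀ x, |v x| ≤ K) → ∫ x, |v x| ≤ K := fun {v} hv => by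
    have := norm_integral_le_of_norm_le_const (μ := (volume : Measure S1)) (f := fun x => |v x|)
      (Eventually.of_forall fun x => (by simpa using hv x))
    rw [probReal_univ, mul_one] at this
    exact (le_abs_self _).trans this
  -- In `c²` one factor is bounded by the `L¹` norm, the other by a multiple of `K (1 + y)^{-(m +
  -- 1)}` through the derivative of order `2 (m + 1)`; a summable `(1 + y)⁻¹` remains.
  have hterm : ∀ n : ℤ,
      (1 + (2 * Real.pi * n) ^ 2) ^ m * ‖fourierCoeff (fun x => (u x : ℂ)) n‖ ^ 2 ≤
        2 ^ (m + 1) * (2 * K) * (∫ x, |u x|) * (1 + (2 * Real.pi * n) ^ 2)⁻¹ := by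
    intro n
    set c := ‖fourierCoeff (fun x => (u x : ℂ)) n‖
    have hc0 : 0 ≤ c := norm_nonneg _
    have h1 : c ≤ ∫ x, |u x| := norm_fourierCoeff_le u n
    have h2 : c ≤ K := h1.trans (hint hK)
    have h3 : ((2 * Real.pi * n) ^ 2) ^ (m + 1) * c ≤ K := by
      have := norm_fourierCoeff_le (circleD^[2 * (m + 1)] u) n
      rw [norm_fourierCoeff_iterate_circleD hu, pow_mul, sq_abs] at this
      exact this.trans (hint hK')
    set y := (2 * Real.pi * (n : ℝ)) ^ 2
    have hy : 0 ≤ y := sq_nonneg _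
    have h4 : (1 + y) ^ (m + 1) ≤ 2 ^ (m + 1) * (1 + y ^ (m + 1)) := by
      have e1 : 1 + y ≤ 2 * max 1 y := by
        rcases le_total 1 y with h | h
        · rw [max_eq_right h]; linarith
        · rw [max_eq_left h]; linarith
      calc (1 + y) ^ (m + 1) ≤ (2 * max 1 y) ^ (m + 1) := pow_le_pow_left₀ (by linarith) e1 _
        _ = 2 ^ (m + 1) * max 1 y ^ (m + 1) := mul_pow _ _ _
        _ ≤ _ := by
          refine mul_le_mul_of_nonneg_left ?_ (by positivity)
          rcases le_total 1 y with h | h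
          · rw [max_eq_right h]; linarith
          · rw [max_eq_left h, one_pow]; linarith [pow_nonneg hy (m + 1)]
    have h5 : (1 + y) ^ (m + 1) * c ≤ 2 ^ (m + 1) * (2 * K) := by
      calc (1 + y) ^ (m + 1) * c ≤ 2 ^ (m + 1) * (1 + y ^ (m + 1)) * c := by gcongr
        _ = 2 ^ (m + 1) * (c + y ^ (m + 1) * c) := by ring
        _ ≤ _ := mul_le_mul_of_nonneg_left (by linarith) (by positivity)
    rw [← div_eq_mul_inv, le_div_iff₀ (by positivity)]
    calc (1 + y) ^ m * c ^ 2 * (1 + y) = (1 + y) ^ (m + 1) * c * c := by ring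
      _ ≤ 2 ^ (m + 1) * (2 * K) * ∫ x, |u x| :=
        mul_le_mul h5 h1 hc0 ((by positivity : 0 ≤ (1 + y) ^ (m + 1) * c).trans h5)
  have hs2 := hsum.mul_left (2 ^ (m + 1) * (2 * K) * (∫ x, |u x|))
  calc ∑' n : ℤ, ENNReal.ofReal
        ((1 + (2 * Real.pi * n) ^ 2) ^ m * ‖fourierCoeff (fun x => (u x : ℂ)) n‖ ^ 2)
      ≤ ∑' n : ℤ, ENNReal.ofReal
        (2 ^ (m + 1) * (2 * K) * (∫ x, |u x|) * (1 + (2 * Real.pi * n) ^ 2)⁻¹) :=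
        ENNReal.tsum_le_tsum fun n => ENNReal.ofReal_le_ofReal (hterm n)
    _ = ENNReal.ofReal (2 ^ (m + 1) * (2 * K) * S * ∫ x, |u x|) := by
        rw [← ENNReal.ofReal_tsum_of_nonneg (fun n => le_trans (by positivity) (hterm n)) hs2,
          tsum_mul_left]
        congr 1
        ring

/-! ### Lifts and distances of smooth torus maps -/

namespace SmoothTorusMap

variable (f g : SmoothTorusMap)

theorem contDiff_lift : ContDiff ℝ (⊤ : ℕ∞) f.lift := f.exists_lift.choose_spec.1

theorem apply_torusProj (p : ℝ × ℝ) : f (torusProj p) = torusProj (f.lift p) :=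
  f.exists_lift.choose_spec.2 p

theorem continuous : Continuous f := by
  have hq : Topology.IsQuotientMap torusProj :=
    ((QuotientAddGroup.isOpenQuotientMap_mk (N := AddSubgroup.zmultiples (1 : ℝ))).prodMap
      (QuotientAddGroup.isOpenQuotientMap_mk (N := AddSubgroup.zmultiples (1 : ℝ)))).isQuotientMap
  rw [hq.continuous_iff]
  have hc : Continuous ((↑) : ℝ → S1) := AddCircle.continuous_mk' 1
  have h1 := f.contDiff_lift.continuous
  have : (f : T2 → T2) ∘ torusProj = fun p => torusProj (f.lift p) := funext f.apply_torusProj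
  rw [this]
  exact (hc.comp h1.fst).prodMk (hc.comp h1.snd)

theorem lift_add_int (v : ℤ × ℤ) : ∃ c : ℝ × ℝ, ∀ p : ℝ × ℝ,
    f.lift (p + ((v.1 : ℝ), (v.2 : ℝ))) = f.lift p + c := by
  have hF := f.contDiff_lift.continuous
  have hint : ∀ p : ℝ × ℝ,
      torusProj (f.lift (p + ((v.1 : ℝ), (v.2 : ℝ)))) = torusProj (f.lift p) := by
    intro p
    rw [← f.apply_torusProj, ← f.apply_torusProj]
    congr 1
    exact Prod.ext (coe_eq_coe_iff.2 ⟨v.1, rfl⟩) (coe_eq_coe_iff.2 ⟨v.2, rfl⟩)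
  have h1 := fun p q => eq_of_continuous_of_forall_int
    (f := fun p : ℝ × ℝ => (f.lift (p + ((v.1 : ℝ), (v.2 : ℝ)))).1 - (f.lift p).1) (by fun_prop)
    (fun p => by
      obtain ⟨n, hn⟩ := coe_eq_coe_iff.1 (congrArg Prod.fst (hint p))
      exact ⟨n, by linarith⟩) p q
  have h2 := fun p q => eq_of_continuous_of_forall_int
    (f := fun p : ℝ × ℝ => (f.lift (p + ((v.1 : ℝ), (v.2 : ℝ)))).2 - (f.lift p).2) (by fun_prop)
    (fun p => by
      obtain ⟨n, hn⟩ := coe_eq_coe_iff.1 (congrArg Prod.snd (hint p))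
      exact ⟨n, by linarith⟩) p q
  refine ⟨f.lift (0 + ((v.1 : ℝ), (v.2 : ℝ))) - f.lift 0, fun p => Prod.ext ?_ ?_⟩
  · have := h1 p 0
    simp only [Prod.fst_add, Prod.fst_sub] at this ⊢
    linarith
  · have := h2 p 0
    simp only [Prod.snd_add, Prod.snd_sub] at this ⊢
    linarith

theorem iteratedFDeriv_lift_add_int {i : ℕ} (hi : i ≠ 0) (v : ℤ × ℤ) (p : ℝ × ℝ) :
    iteratedFDeriv ℝ i f.lift (p + ((v.1 : ℝ), (v.2 : ℝ))) = iteratedFDeriv ℝ i f.lift p := by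
  obtain ⟨c, hc⟩ := f.lift_add_int v
  rw [← iteratedFDeriv_comp_add_right, funext hc]
  have h1 : (fun p => f.lift p + c) = f.lift + fun _ => c := rfl
  rw [h1, iteratedFDeriv_add (f.contDiff_lift.of_le (by exact_mod_cast le_top)) contDiff_const,
    Pi.add_apply, iteratedFDeriv_const_of_ne hi, Pi.zero_apply, add_zero]

/-- Periodicity reduces to the unit square. Boundedness matters: an unbounded real supremum is `0`
by convention, and `distC` would then control nothing. -/
theorem bddAbove_iteratedFDeriv_sub {i : ℕ} (hi : i ≠ 0) :
    BddAbove (Set.range fun p : ℝ × ℝ =>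
      ‖iteratedFDeriv ℝ i f.lift p - iteratedFDeriv ℝ i g.lift p‖) := by
  have hc : Continuous fun p : ℝ × ℝ =>
      ‖iteratedFDeriv ℝ i f.lift p - iteratedFDeriv ℝ i g.lift p‖ :=
    ((f.contDiff_lift.continuous_iteratedFDeriv (by exact_mod_cast le_top)).sub
      (g.contDiff_lift.continuous_iteratedFDeriv (by exact_mod_cast le_top))).norm
  obtain ⟨K, hK⟩ := ((isCompact_Icc (a := (0 : ℝ)) (b := 1)).prod
    (isCompact_Icc (a := (0 : ℝ)) (b := 1))).bddAbove_image hc.continuousOn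
  refine ⟨K, ?_⟩
  rintro _ ⟨p, rfl⟩
  have hp : p = (Int.fract p.1, Int.fract p.2) + ((⌊p.1⌋ : ℝ), (⌊p.2⌋ : ℝ)) :=
    Prod.ext (Int.fract_add_floor _).symm (Int.fract_add_floor _).symm
  have h1 := f.iteratedFDeriv_lift_add_int hi (⌊p.1⌋, ⌊p.2⌋) (Int.fract p.1, Int.fract p.2)
  have h2 := g.iteratedFDeriv_lift_add_int hi (⌊p.1⌋, ⌊p.2⌋) (Int.fract p.1, Int.fract p.2)
  rw [← hp] at h1 h2
  simp only [h1, h2]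
  exact hK ⟨_, ⟨⟨Int.fract_nonneg _, (Int.fract_lt_one _).le⟩,
    ⟨Int.fract_nonneg _, (Int.fract_lt_one _).le⟩⟩, rfl⟩

theorem iSup_iteratedFDeriv_sub_nonneg (i : ℕ) :
    0 ≤ ⨆ p : ℝ × ℝ, ‖iteratedFDeriv ℝ i f.lift p - iteratedFDeriv ℝ i g.lift p‖ :=
  Real.iSup_nonneg fun _ => norm_nonneg _

theorem iSup_dist_nonneg : 0 ≤ ⨆ z : T2, dist (f z) (g z) := Real.iSup_nonneg fun _ => dist_nonneg

theorem distC_nonneg (j : ℕ) : 0 ≤ distC j f g :=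
  add_nonneg (f.iSup_dist_nonneg g)
    (Finset.sum_nonneg fun i _ => f.iSup_iteratedFDeriv_sub_nonneg g i)

theorem dist_le_distC (j : ℕ) (z : T2) : dist (f z) (g z) ≤ distC j f g := by
  have hb : BddAbove (Set.range fun z : T2 => dist (f z) (g z)) :=
    (isCompact_range (f.continuous.dist g.continuous)).bddAbove
  exact (le_ciSup hb z).trans (le_add_of_nonneg_right
    (Finset.sum_nonneg fun i _ => f.iSup_iteratedFDeriv_sub_nonneg g i))

theorem norm_iteratedFDeriv_sub_le_distC {i j : ℕ} (hi : i ≠ 0) (hij : i ≤ j) (p : ℝ × ℝ) :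
    ‖iteratedFDeriv ℝ i f.lift p - iteratedFDeriv ℝ i g.lift p‖ ≤ distC j f g :=
  (le_ciSup (f.bddAbove_iteratedFDeriv_sub g hi) p).trans
    ((Finset.single_le_sum (fun i _ => f.iSup_iteratedFDeriv_sub_nonneg g i)
      (Finset.mem_Icc.2 ⟨Nat.one_le_iff_ne_zero.2 hi, hij⟩)).trans
      (le_add_of_nonneg_left (f.iSup_dist_nonneg g)))

/-- A single term is at most the whole series, and `t / (1 + t)` is increasing. -/
theorem distC_le_of_distCinf_le (j : ℕ) {η : ℝ} (hη : 0 < η)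
    (h : distCinf f g ≤ (2 : ℝ)⁻¹ ^ j * (η / (1 + η))) : distC j f g ≤ η := by
  have hnn : ∀ j, 0 ≤ distC j f g / (1 + distC j f g) := fun j =>
    div_nonneg (f.distC_nonneg g j) (by linarith [f.distC_nonneg g j])
  have hs : Summable fun j : ℕ => (2 : ℝ)⁻¹ ^ j * (distC j f g / (1 + distC j f g)) := by
    refine Summable.of_nonneg_of_le (fun j => mul_nonneg (by positivity) (hnn j)) (fun j => ?_)
      (summable_geometric_of_lt_one (r := (2 : ℝ)⁻¹) (by norm_num) (by norm_num))
    refine mul_le_of_le_one_right (by positivity) ?_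
    have := f.distC_nonneg g j
    rw [div_le_one (by linarith)]
    linarith
  have h1 := (hs.le_tsum j fun i _ => mul_nonneg (by positivity) (hnn i)).trans h
  have h2 := le_of_mul_le_mul_left h1 (by positivity)
  have h3 := f.distC_nonneg g j
  rw [div_le_div_iff₀ (by linarith) (by linarith)] at h2
  linarith

/-- A lift of the circle map underlying `f`. -/
noncomputable def baseLift (t : ℝ) : ℝ := (f.lift (t, 0)).1

theorem contDiff_baseLift : ContDiff ℝ (⊤ : ℕ∞) f.baseLift :=
  contDiff_fst.comp (f.contDiff_lift.comp (contDiff_id.prodMk contDiff_const))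

theorem baseMap_coe (t : ℝ) : baseMap f (t : S1) = (f.baseLift t : S1) := by
  have := congrArg Prod.fst (f.apply_torusProj (t, 0))
  simpa [torusProj, baseMap, baseLift] using this

theorem iteratedDeriv_baseLift (i : ℕ) (t : ℝ) :
    iteratedDeriv i f.baseLift t = (iteratedFDeriv ℝ i f.lift (t, 0) fun _ => (1, 0)).1 := by
  have h1 : f.baseLift = ContinuousLinearMap.fst ℝ ℝ ℝ ∘
      (f.lift ∘ ContinuousLinearMap.inl ℝ ℝ ℝ) := rfl
  have hi : ((i : ℕ∞) : WithTop ℕ∞) ≤ ((⊤ : ℕ∞) : WithTop ℕ∞) := by exact_mod_cast le_top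
  have h2 : ContDiff ℝ (⊤ : ℕ∞) (f.lift ∘ ContinuousLinearMap.inl ℝ ℝ ℝ) :=
    f.contDiff_lift.comp (ContinuousLinearMap.contDiff _)
  rw [iteratedDeriv_eq_iteratedFDeriv, h1,
    ContinuousLinearMap.iteratedFDeriv_comp_left _ h2.contDiffAt hi,
    ContinuousLinearMap.iteratedFDeriv_comp_right _ f.contDiff_lift _ hi]
  simp

theorem abs_iteratedDeriv_baseLift_sub_le {i j : ℕ} (hi : i ≠ 0) (hij : i ≤ j) (t : ℝ) :
    |iteratedDeriv i f.baseLift t - iteratedDeriv i g.baseLift t| ≤ distC j f g := by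
  refine le_trans ?_ (f.norm_iteratedFDeriv_sub_le_distC g hi hij (t, 0))
  rw [iteratedDeriv_baseLift, iteratedDeriv_baseLift, ← Prod.fst_sub,
    ← sub_apply, ← Real.norm_eq_abs]
  refine (norm_fst_le _).trans ((ContinuousMultilinearMap.le_opNorm _ _).trans_eq ?_)
  simp [Prod.norm_def]

theorem circleDeriv_baseMap_coe (t : ℝ) : circleDeriv (baseMap f) (t : S1) = deriv f.baseLift t :=
  circleDeriv_coe (f.contDiff_baseLift.differentiable (by simp)) f.baseMap_coe t

theorem isExpandingLift (h : ∀ x, 1 ≤ circleDeriv (baseMap f) x) :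
    IsExpandingLift (baseMap f) f.baseLift :=
  ⟨f.contDiff_baseLift, f.baseMap_coe, fun t => (h t).trans_eq (f.circleDeriv_baseMap_coe t)⟩

theorem iterate_circleD_circleDeriv (j : ℕ) (t : ℝ) :
    circleD^[j] (circleDeriv (baseMap f)) (t : S1) = iteratedDeriv (j + 1) f.baseLift t := by
  rw [iterate_circleD_coe, funext f.circleDeriv_baseMap_coe, iteratedDeriv_succ']

theorem abs_iterate_circleD_circleDeriv_sub_le {j m : ℕ} (hj : j + 1 ≤ m) (x : S1) :
    |circleD^[j] (circleDeriv (baseMap f)) x - circleD^[j] (circleDeriv (baseMap g)) x| ≤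
      distC m f g := by
  refine forall_circle (p := fun x => |circleD^[j] (circleDeriv (baseMap f)) x -
    circleD^[j] (circleDeriv (baseMap g)) x| ≤ distC m f g) (fun t => ?_) x
  rw [iterate_circleD_circleDeriv, iterate_circleD_circleDeriv]
  exact f.abs_iteratedDeriv_baseLift_sub_le g j.succ_ne_zero hj t

theorem dist_baseMap_le_distC (j : ℕ) (x : S1) : dist (baseMap f x) (baseMap g x) ≤ distC j f g :=
  (le_max_left _ _).trans (f.dist_le_distC g j (x, 0))

/-- Torus maps at bounded distance from a given one have base maps in an expanding class. -/
theorem exists_expClass (h : ∀ x, 1 ≤ circleDeriv (baseMap f) x) (N : ℕ) (C : ℝ) :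
    ∃ B, ∀ g : SmoothTorusMap, ∀ l : ℝ, 1 ≤ l → (∀ x, l ≤ circleDeriv (baseMap g) x) →
      distC (N + 1) g f ≤ C → ExpClass N l B (baseMap g) := by
  have hq := (f.isExpandingLift h).isSmoothCircleFun_circleDeriv
  have hb : ∀ j, ∃ K, ∀ x, |circleD^[j] (circleDeriv (baseMap f)) x| ≤ K := fun j => by
    obtain ⟨K, hK⟩ := (isCompact_range (hq.iterate_circleD j).continuous.abs).bddAbove
    exact ⟨K, fun x => hK ⟨x, rfl⟩⟩
  choose K hK using hb
  refine ⟨∑ j ∈ Finset.range (N + 1), |K j| + C, fun g l hl hg hC => ⟨⟨_, g.isExpandingLift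
    fun x => hl.trans (hg x)⟩, hg, fun j hj x => ?_⟩⟩
  have h1 := (g.abs_iterate_circleD_circleDeriv_sub_le f
    (show j + 1 + 1 ≤ N + 1 by omega) x).trans hC
  have h2 := (hK (j + 1) x).trans (le_abs_self _)
  have h3 := Finset.single_le_sum (f := fun j => |K j|) (fun i _ => abs_nonneg _)
    (Finset.mem_range.2 (show j + 1 < N + 1 by omega))
  have h4 := abs_sub_abs_le_abs_sub (circleD^[j + 1] (circleDeriv (baseMap g)) x)
    (circleD^[j + 1] (circleDeriv (baseMap f)) x)
  linarith

theorem one_lt_iInf_circleDeriv (h : ∀ x, 1 < circleDeriv (baseMap f) x) :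
    1 < ⨅ x, circleDeriv (baseMap f) x := by
  have hc := (f.isExpandingLift fun x => (h x).le).isSmoothCircleFun_circleDeriv.continuous
  obtain ⟨x, -, hx⟩ := isCompact_univ.exists_isMinOn Set.univ_nonempty hc.continuousOn
  exact (h x).trans_le (le_ciInf fun y => hx (Set.mem_univ y))

theorem iInf_circleDeriv_le (h : ∀ x, 1 < circleDeriv (baseMap f) x) (x : S1) :
    ⨅ x, circleDeriv (baseMap f) x ≤ circleDeriv (baseMap f) x :=
  ciInf_le ⟨1, by rintro _ ⟨y, rfl⟩; exact (h y).le⟩ x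

end SmoothTorusMap

theorem eventually_ae_distC_le {Ω : Type*} [MeasurableSpace Ω] {P : Measure Ω}
    {f₀ : SmoothTorusMap} {f : ℝ → Ω → SmoothTorusMap}
    (hconv : Tendsto (fun ε => essSup (fun ω => ENNReal.ofReal (distCinf (f ε ω) f₀)) P)
      (𝓝[>] 0) (𝓝 0)) (j : ℕ) {η : ℝ} (hη : 0 < η) :
    ∀ᶠ ε in 𝓝[>] 0, ∀ᵐ ω ∂P, distC j (f ε ω) f₀ ≤ η := by
  have hpos : 0 < (2 : ℝ)⁻¹ ^ j * (η / (1 + η)) := by positivity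
  filter_upwards [hconv.eventually (gt_mem_nhds (ENNReal.ofReal_pos.2 hpos))] with ε hε
  filter_upwards [ae_lt_of_essSup_lt hε] with ω hω
  exact SmoothTorusMap.distC_le_of_distCinf_le _ _ j hη
    ((ENNReal.ofReal_lt_ofReal_iff hpos).1 hω).le

/-! ### Measurable dependence on parameters -/

/-- A tent function on the circle, concentrated at the origin as `j` tends to infinity. -/
noncomputable def tent (j : ℕ) (z : S1) : ℝ := max 0 (1 - (j + 1) * ‖z‖)

theorem continuous_tent (j : ℕ) : Continuous (tent j) := by unfold tent; fun_prop

theorem tent_nonneg (j : ℕ) (z : S1) : 0 ≤ tent j z := le_max_left _ _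

theorem integral_tent_pos (j : ℕ) : 0 < ∫ z, tent j z :=
  (continuous_tent j).integral_pos_of_hasCompactSupport_nonneg_nonzero (x := 0)
    (HasCompactSupport.of_compactSpace _) (tent_nonneg j) (by simp [tent])

/-- Recovers point values from integrals; with duality this gives joint measurability of transfer
operators without a measurable choice of inverse branches. -/
theorem tendsto_tent_average {u : S1 → ℝ} (hu : Continuous u) (x : S1) :
    Tendsto (fun j => (∫ z, tent j (z - x) * u z) / ∫ z, tent j z) atTop (𝓝 (u x)) := by
  rw [Metric.tendsto_atTop]
  intro ε hε
  obtain ⟨δ, hδ, h⟩ := Metric.continuousAt_iff.1 hu.continuousAt (ε / 2) (half_pos hε)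
  obtain ⟨N, hN⟩ := exists_nat_gt δ⁻¹
  refine ⟨N, fun j hj => ?_⟩
  have hjδ : 1 < (j + 1) * δ := by
    have h1 : δ⁻¹ < j + 1 := hN.trans_le (by exact_mod_cast hj.trans j.le_succ)
    rwa [inv_lt_iff_one_lt_mul₀ hδ] at h1
  have hpos := integral_tent_pos j
  have hshift : ∫ z, tent j (z - x) = ∫ z, tent j z := integral_sub_right_eq_self _ x
  have hct : Continuous fun z => tent j (z - x) :=
    (continuous_tent j).comp (continuous_id.sub continuous_const)
  have hsub : (∫ z, tent j (z - x) * u z) - u x * ∫ z, tent j z =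
      ∫ z, tent j (z - x) * (u z - u x) := by
    rw [← hshift, ← integral_const_mul, ← integral_sub (Continuous.integrable_circle (by fun_prop))
      (Continuous.integrable_circle (by fun_prop))]
    congr 1
    funext z
    ring
  have hle : ‖∫ z, tent j (z - x) * (u z - u x)‖ ≤ ∫ z, tent j (z - x) * (ε / 2) := by
    refine norm_integral_le_of_norm_le (Continuous.integrable_circle (by fun_prop))
      (Eventually.of_forall fun z => ?_)
    rw [norm_mul, Real.norm_of_nonneg (tent_nonneg _ _)]
    by_cases hz : dist z x < δ
    · exact mul_le_mul_of_nonneg_left (h hz).le (tent_nonneg _ _)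
    · have : tent j (z - x) = 0 := by
        rw [dist_eq_norm, not_lt] at hz
        refine max_eq_left ?_
        have : ((j : ℝ) + 1) * δ ≤ (j + 1) * ‖z - x‖ := by gcongr
        linarith
      simp [this]
  rw [integral_mul_const, hshift] at hle
  rw [Real.dist_eq, div_sub' hpos.ne', abs_div, abs_of_pos hpos, div_lt_iff₀ hpos,
    mul_comm _ (u x), hsub]
  refine hle.trans_lt ?_
  nlinarith

section

variable {Ω : Type*} [MeasurableSpace Ω]

/-- Averages of `M φ` against a tent centred at `x` equal `∫ φ(y) tent(E y - x) dy`, a parameter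
integral of a jointly measurable function. -/
theorem measurable_transferOp {E : Ω → S1 → S1} {φ : Ω → S1 → ℝ}
    (hE : Measurable fun q : Ω × S1 => E q.1 q.2) (hφ : Measurable fun q : Ω × S1 => φ q.1 q.2)
    (hF : ∀ ω, ∃ F, IsExpandingLift (E ω) F) (hc : ∀ ω, Continuous (φ ω)) :
    Measurable fun q : Ω × S1 => transferOp (E q.1) (φ q.1) q.2 := by
  refine measurable_of_tendsto_metrizable (f := fun j (q : Ω × S1) =>
    (∫ y, φ q.1 y * tent j (E q.1 y - q.2)) / ∫ z, tent j z) (fun j => ?_) ?_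
  · refine Measurable.div_const (StronglyMeasurable.measurable ?_) _
    refine StronglyMeasurable.integral_prod_right' (f := fun p : (Ω × S1) × S1 =>
      φ p.1.1 p.2 * tent j (E p.1.1 p.2 - p.1.2)) (Measurable.stronglyMeasurable ?_)
    have h1 : Measurable fun p : (Ω × S1) × S1 => (p.1.1, p.2) := by fun_prop
    exact (hφ.comp h1).mul ((continuous_tent j).measurable.comp ((hE.comp h1).sub (by fun_prop)))
  · rw [tendsto_pi_nhds]
    rintro ⟨ω, x⟩
    obtain ⟨F, hF⟩ := hF ω
    have hct : ∀ j, Continuous fun z => tent j (z - x) := fun j =>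
      (continuous_tent j).comp (continuous_id.sub continuous_const)
    have h1 := tendsto_tent_average (hF.continuous_transferOp (hc ω)) x
    refine h1.congr fun j => ?_
    simp only
    rw [← hF.integral_transferOp_mul (hc ω) (hct j)]
    simp only [mul_comm]

theorem measurable_pullback {s : Ω → ℕ → S1 → S1}
    (hs : ∀ j, Measurable fun q : Ω × S1 => s q.1 j q.2)
    (hF : ∀ ω j, ∃ F, IsExpandingLift (s ω j) F) (n : ℕ) :
    Measurable fun q : Ω × S1 => pullback n (s q.1) (fun _ => 1) q.2 := by
  induction n generalizing s with
  | zero => exact measurable_const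
  | succ n ih =>
    exact measurable_transferOp (E := fun ω => s ω 0)
      (φ := fun ω => pullback n (fun j => s ω (j + 1)) fun _ => 1) (hs 0)
      (ih (s := fun ω j => s ω (j + 1)) (fun j => hs (j + 1)) fun ω j => hF ω (j + 1))
      (fun ω => hF ω 0)
      (fun ω => ((IsSmoothCircleFun.const 1).pullback (fun j => hF ω (j + 1)) n).continuous)

theorem measurable_pullbackDensity {l : ℝ} (hl : 1 < l) {s : Ω → ℕ → S1 → S1}
    (hs : ∀ j, Measurable fun q : Ω × S1 => s q.1 j q.2) (hF : ∀ ω, ExpSeq l (s ω)) :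
    Measurable fun q : Ω × S1 => pullbackDensity (s q.1) q.2 := by
  refine measurable_of_tendsto_metrizable
    (fun n => measurable_pullback hs (fun ω => (hF ω).exists_lift) n) ?_
  rw [tendsto_pi_nhds]
  rintro ⟨ω, x⟩
  obtain ⟨B, hB⟩ := hF ω 1
  exact tendsto_pullbackDensity hl hB x

end

/-! ### Random expanding maps -/

section

variable {Ω : Type*} [MeasurableSpace Ω] {l : ℝ} {θ : Ω ≃ᵐ Ω} {E : Ω → S1 → S1}

/-- A measurable family of circle maps, uniformly expanding with uniformly bounded derivatives. -/
structure IsRandomExpanding (l : ℝ) (E : Ω → S1 → S1) : Prop where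
  measurable : Measurable fun q : Ω × S1 => E q.1 q.2
  expClass : ∀ N, ∃ B, ∀ ω, ExpClass N l B (E ω)

/-- The maps applied at the times `-1, -2, …`. -/
def past (θ : Ω ≃ᵐ Ω) (E : Ω → S1 → S1) (ω : Ω) (j : ℕ) : S1 → S1 := E (θ.symm^[j + 1] ω)

/-- The equivariant density of a random expanding map. -/
noncomputable def equivariantDensity (θ : Ω ≃ᵐ Ω) (E : Ω → S1 → S1) (ω : Ω) : S1 → ℝ :=
  pullbackDensity (past θ E ω)

theorem past_apply_succ (ω : Ω) (j : ℕ) : past θ E (θ ω) (j + 1) = past θ E ω j := by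
  simp [past, Function.iterate_succ_apply]

theorem past_apply_zero (ω : Ω) : past θ E (θ ω) 0 = E ω := by simp [past]

namespace IsRandomExpanding

theorem exists_lift (h : IsRandomExpanding l E) (ω : Ω) : ∃ F, IsExpandingLift (E ω) F :=
  let ⟨_, hB⟩ := h.expClass 0
  (hB ω).exists_lift

theorem expSeq (h : IsRandomExpanding l E) (θ : Ω ≃ᵐ Ω) (ω : Ω) : ExpSeq l (past θ E ω) := fun N =>
  let ⟨B, hB⟩ := h.expClass N
  ⟨B, fun _ => hB _⟩

theorem measurable_equivariantDensity (h : IsRandomExpanding l E) (hl : 1 < l) :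
    Measurable fun q : Ω × S1 => equivariantDensity θ E q.1 q.2 := by
  refine measurable_pullbackDensity hl (fun j => ?_) (h.expSeq θ)
  have hj : Measurable (θ.symm^[j + 1]) := θ.symm.measurable.iterate _
  exact h.measurable.comp ((hj.comp measurable_fst).prodMk measurable_snd)

theorem transferOp_equivariantDensity (h : IsRandomExpanding l E) (hl : 1 < l) (ω : Ω) :
    transferOp (E ω) (equivariantDensity θ E ω) = equivariantDensity θ E (θ ω) := by
  obtain ⟨B, hB⟩ := h.expClass 1
  have := transferOp_pullbackDensity hl (s := past θ E (θ ω)) fun j => hB _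
  rwa [past_apply_zero, funext (past_apply_succ ω)] at this

theorem smooth (h : IsRandomExpanding l E) (hl : 1 < l) (ω : Ω) :
    IsSmoothCircleFun (equivariantDensity θ E ω) :=
  (h.expSeq θ ω).isSmoothCircleFun_pullbackDensity hl

theorem pos (h : IsRandomExpanding l E) (hl : 1 < l) (ω : Ω) (x : S1) :
    0 < equivariantDensity θ E ω x :=
  (h.expSeq θ ω).pullbackDensity_pos hl x

theorem integral_eq_one (h : IsRandomExpanding l E) (hl : 1 < l) (ω : Ω) :
    ∫ x, equivariantDensity θ E ω x = 1 :=
  (h.expSeq θ ω).integral_pullbackDensity hl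

theorem transferOp_cocycle (h : IsRandomExpanding l E) (hl : 1 < l) (ω : Ω) (n : ℕ) :
    (∃ F, IsExpandingLift (cocycle θ E n ω) F) ∧
      transferOp (cocycle θ E n ω) (equivariantDensity θ E ω) =
        equivariantDensity θ E (θ^[n] ω) := by
  induction n with
  | zero => exact ⟨⟨_, IsExpandingLift.id⟩, transferOp_id _⟩
  | succ n ih =>
    obtain ⟨⟨F, hF⟩, heq⟩ := ih
    obtain ⟨F', hF'⟩ := h.exists_lift (θ^[n] ω)
    refine ⟨⟨_, hF'.comp hF⟩, ?_⟩
    rw [cocycle, transferOp_comp hF hF' (h.smooth hl ω).continuous, heq,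
      h.transferOp_equivariantDensity hl, Function.iterate_succ_apply']

/-- Both initial densities lie in a common cone, whose slope, and hence the rate, depends on `ω`.
The convergence is therefore not uniform in `ω`, and uniqueness goes through dominated convergence.
-/
theorem exists_forward_contraction (h : IsRandomExpanding l E) (hl : 1 < l) {ω : Ω}
    {u : ℕ → S1 → ℝ}
    (h0 : IsSmoothCircleFun (u 0)) (hpos : ∀ x, 0 < u 0 x) (hint : ∫ x, u 0 x = 1)
    (hu : ∀ n, transferOp (E (θ^[n] ω)) (u n) = u (n + 1)) :
    ∃ ρ C, 0 ≤ ρ ∧ ρ < 1 ∧ ∀ n x, |u n x - equivariantDensity θ E (θ^[n] ω) x| ≤ C * ρ ^ n := by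
  obtain ⟨b₁, hb₁⟩ := exists_isConeDensity h0 hpos hint
  obtain ⟨b₂, hb₂⟩ := exists_isConeDensity (h.smooth (θ := θ) hl ω) (h.pos hl ω)
    (h.integral_eq_one hl ω)
  obtain ⟨B, hB⟩ := h.expClass 1
  obtain ⟨a₀, ha₀, hcone⟩ := exists_transferOp_isConeDensity le_rfl hl B
  set a := max a₀ (max b₁ b₂)
  have ha : 0 ≤ a := ha₀.trans (le_max_left _ _)
  obtain ⟨κ, hκ0, hκ1, hκ⟩ := hcone a (le_max_left _ _)
  refine ⟨1 - κ, Real.exp a, by linarith, by linarith, fun n => ?_⟩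
  have key : ∃ φ ψ, IsConeDensity a φ ∧ IsConeDensity a ψ ∧
      (fun x => u n x - equivariantDensity θ E (θ^[n] ω) x) =
        fun x => (1 - κ) ^ n * (φ x - ψ x) := by
    induction n with
    | zero => exact ⟨_, _, hb₁ a ((le_max_left _ _).trans (le_max_right _ _)),
        hb₂ a ((le_max_right _ _).trans (le_max_right _ _)), by simp⟩
    | succ n ih =>
      obtain ⟨φ, ψ, hφ, hψ, heq⟩ := ih
      obtain ⟨F, hF⟩ := h.exists_lift (θ^[n] ω)
      obtain ⟨φ', hφ', e1⟩ := (hκ _ (hB (θ^[n] ω)) φ hφ).2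
      obtain ⟨ψ', hψ', e2⟩ := (hκ _ (hB (θ^[n] ω)) ψ hψ).2
      refine ⟨φ', ψ', hφ', hψ', ?_⟩
      rw [← hu n, Function.iterate_succ_apply', ← h.transferOp_equivariantDensity hl,
        ← hF.transferOp_sub, heq, hF.transferOp_const_mul, hF.transferOp_sub]
      funext x
      simp only [e1, e2]
      ring
  obtain ⟨φ, ψ, hφ, hψ, heq⟩ := key
  intro x
  rw [congrFun heq x, abs_mul, abs_of_nonneg (pow_nonneg (by linarith) n), mul_comm]
  exact mul_le_mul_of_nonneg_right (hφ.abs_sub_le hψ ha x) (pow_nonneg (by linarith) n)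

/-- Uniqueness of equivariant densities. -/
theorem ae_eq_equivariantDensity (h : IsRandomExpanding l E) (hl : 1 < l)
    {P : Measure Ω} [IsProbabilityMeasure P]
    (hθ : MeasurePreserving θ P P) {u : Ω → S1 → ℝ} (hm : Measurable fun q : Ω × S1 => u q.1 q.2)
    (hsm : ∀ᵐ ω ∂P, IsSmoothCircleFun (u ω)) (hpos : ∀ᵐ ω ∂P, ∀ x, 0 < u ω x)
    (hint : ∀ᵐ ω ∂P, ∫ x, u ω x = 1) (hu : ∀ᵐ ω ∂P, transferOp (E ω) (u ω) = u (θ ω)) :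
    ∀ᵐ ω ∂P, u ω = equivariantDensity θ E ω := by
  set d := equivariantDensity θ E
  let A : Ω → ℝ≥0∞ := fun ω => ∫⁻ x, ENNReal.ofReal |u ω x - d ω x|
  have hdm := h.measurable_equivariantDensity (θ := θ) hl
  have hAm : Measurable A := Measurable.lintegral_prod_right'
    (f := fun q : Ω × S1 => ENNReal.ofReal |u q.1 q.2 - d q.1 q.2|)
    (ENNReal.measurable_ofReal.comp (hm.sub hdm).abs)
  have hθn : ∀ n : ℕ, MeasurePreserving (θ^[n]) P P := fun n => hθ.iterate n
  have hle : ∀ᵐ ω ∂P, A ω ≤ 2 := by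
    filter_upwards [hsm, hpos, hint] with ω h1 h2 h3
    calc A ω ≤ ∫⁻ x, (ENNReal.ofReal (u ω x) + ENNReal.ofReal (d ω x)) := by
          refine lintegral_mono fun x => ?_
          rw [← ENNReal.ofReal_add (h2 x).le (h.pos hl ω x).le]
          refine ENNReal.ofReal_le_ofReal (abs_le.2 ⟨?_, ?_⟩) <;>
            linarith [h2 x, h.pos (θ := θ) hl ω x]
      _ = ENNReal.ofReal 1 + ENNReal.ofReal 1 := by
          rw [lintegral_add_left h1.continuous.measurable.ennreal_ofReal,
            ← ofReal_integral_eq_lintegral_ofReal h1.continuous.integrable_circle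
              (Eventually.of_forall fun x => (h2 x).le), h3,
            ← ofReal_integral_eq_lintegral_ofReal (h.smooth hl ω).continuous.integrable_circle
              (Eventually.of_forall fun x => (h.pos hl ω x).le), h.integral_eq_one hl ω]
      _ = 2 := by rw [ENNReal.ofReal_one]; norm_num
  have hall : ∀ᵐ ω ∂P, ∀ n : ℕ, transferOp (E (θ^[n] ω)) (u (θ^[n] ω)) = u (θ^[n + 1] ω) := by
    rw [ae_all_iff]
    intro n
    filter_upwards [(hθn n).quasiMeasurePreserving.ae hu] with ω hω
    rw [hω, Function.iterate_succ_apply']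
  have hlim : ∀ᵐ ω ∂P, Tendsto (fun n => A (θ^[n] ω)) atTop (𝓝 0) := by
    filter_upwards [hsm, hpos, hint, hall] with ω h1 h2 h3 h4
    obtain ⟨ρ, C, hρ0, hρ1, hb⟩ := h.exists_forward_contraction (θ := θ) (ω := ω) hl
      (u := fun n => u (θ^[n] ω)) h1 h2 h3 h4
    have hto : Tendsto (fun n => ENNReal.ofReal (C * ρ ^ n)) atTop (𝓝 0) := by
      rw [← ENNReal.ofReal_zero]
      refine ENNReal.tendsto_ofReal ?_
      simpa using (tendsto_pow_atTop_nhds_zero_of_lt_one hρ0 hρ1).const_mul C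
    refine tendsto_of_tendsto_of_tendsto_of_le_of_le tendsto_const_nhds hto (fun _ => zero_le)
      fun n => ?_
    calc A (θ^[n] ω) ≤ ∫⁻ _ : S1, ENNReal.ofReal (C * ρ ^ n) :=
          lintegral_mono fun x => ENNReal.ofReal_le_ofReal (hb n x)
      _ = ENNReal.ofReal (C * ρ ^ n) := by simp
  -- Invariance of `P` freezes the mean `L¹` distance, while the distance itself tends to zero and
  -- is bounded by `2`.
  have hconst : ∀ n : ℕ, ∫⁻ ω, A (θ^[n] ω) ∂P = ∫⁻ ω, A ω ∂P := fun n =>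
    (hθn n).lintegral_comp hAm
  have hdom := tendsto_lintegral_of_dominated_convergence (μ := P)
    (F := fun n ω => A (θ^[n] ω)) (f := fun _ => 0) (fun _ => 2)
    (fun n => hAm.comp (hθn n).measurable)
    (fun n => (hθn n).quasiMeasurePreserving.ae hle) (by simp) hlim
  simp only [hconst, lintegral_zero] at hdom
  have hzero := tendsto_nhds_unique hdom tendsto_const_nhds
  filter_upwards [(lintegral_eq_zero_iff hAm).1 hzero.symm, hsm] with ω h1 h2
  have hc : Continuous fun x => |u ω x - d ω x| :=
    (h2.continuous.sub (h.smooth hl ω).continuous).abs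
  have h3 := (lintegral_eq_zero_iff (ENNReal.measurable_ofReal.comp hc.measurable)).1 h1
  refine (Continuous.ae_eq_iff_eq volume h2.continuous (h.smooth hl ω).continuous).1 ?_
  filter_upwards [h3] with x hx
  have := ENNReal.ofReal_eq_zero.1 hx
  exact sub_eq_zero.1 (abs_nonpos_iff.1 this)

end IsRandomExpanding

end

/-! ### Invariant measures -/

theorem lintegral_ofReal_eq_one {φ : S1 → ℝ} (hc : Continuous φ) (h0 : ∀ x, 0 ≤ φ x)
    (h1 : ∫ x, φ x = 1) : ∫⁻ x, ENNReal.ofReal (φ x) = 1 := by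
  rw [← ofReal_integral_eq_lintegral_ofReal hc.integrable_circle (Eventually.of_forall h0), h1,
    ENNReal.ofReal_one]

theorem lintegral_torus {g : T2 → ℝ≥0∞} (hg : Measurable g) : ∫⁻ z, g z = ∫⁻ x, ∫⁻ s, g (x, s) :=
  lintegral_prod g hg.aemeasurable

theorem isFiniteMeasure_withDensity_circle {φ : S1 → ℝ} (hc : Continuous φ) :
    IsFiniteMeasure ((volume : Measure S1).withDensity fun x => ENNReal.ofReal (φ x)) :=
  isFiniteMeasure_withDensity_ofReal hc.integrable_circle.2

theorem IsExpandingLift.map_withDensity {E : S1 → S1} {F : ℝ → ℝ} (h : IsExpandingLift E F)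
    {φ : S1 → ℝ} (hc : Continuous φ) (h0 : ∀ x, 0 ≤ φ x) :
    Measure.map E ((volume : Measure S1).withDensity fun x => ENNReal.ofReal (φ x)) =
      (volume : Measure S1).withDensity fun x => ENNReal.ofReal (transferOp E φ x) := by
  have hc' := h.continuous_transferOp hc
  have := isFiniteMeasure_withDensity_circle hc
  have := isFiniteMeasure_withDensity_circle hc'
  refine ext_of_forall_integral_eq_of_IsFiniteMeasure fun ψ => ?_
  have hψ : Continuous ψ := ψ.continuous
  rw [integral_map h.continuous.aemeasurable hψ.aestronglyMeasurable,
    integral_withDensity_eq_integral_toReal_smul hc.measurable.ennreal_ofReal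
      (Eventually.of_forall fun _ => ENNReal.ofReal_lt_top),
    integral_withDensity_eq_integral_toReal_smul hc'.measurable.ennreal_ofReal
      (Eventually.of_forall fun _ => ENNReal.ofReal_lt_top)]
  simp only [ENNReal.toReal_ofReal (h0 _), ENNReal.toReal_ofReal (h.transferOp_nonneg h0 _),
    smul_eq_mul]
  exact (h.integral_transferOp_mul hc hψ).symm

/-- A skew product of an expanding map with rotations acts on fibrewise constant densities through
the transfer operator. -/
theorem IsExpandingLift.map_skew_withDensity {E : S1 → S1} {F : ℝ → ℝ} (h : IsExpandingLift E F)
    {c : S1 → S1} (hcm : Measurable c) {φ : S1 → ℝ} (hc : Continuous φ) (h0 : ∀ x, 0 ≤ φ x) :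
    Measure.map (fun z : T2 => (E z.1, z.2 + c z.1))
        ((volume : Measure T2).withDensity fun z => ENNReal.ofReal (φ z.1)) =
      (volume : Measure T2).withDensity fun z => ENNReal.ofReal (transferOp E φ z.1) := by
  have hEm := h.continuous.measurable
  have hΦ : Measurable fun z : T2 => (E z.1, z.2 + c z.1) :=
    (hEm.comp measurable_fst).prodMk (measurable_snd.add (hcm.comp measurable_fst))
  have hφm : Measurable fun z : T2 => ENNReal.ofReal (φ z.1) :=
    (hc.measurable.comp measurable_fst).ennreal_ofReal
  have hMm : Measurable fun z : T2 => ENNReal.ofReal (transferOp E φ z.1) :=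
    ((h.continuous_transferOp hc).measurable.comp measurable_fst).ennreal_ofReal
  refine Measure.ext_of_lintegral _ fun g hg => ?_
  set Γ : S1 → ℝ≥0∞ := fun y => ∫⁻ s : S1, g (y, s)
  have hΓ : Measurable Γ := hg.lintegral_prod_right'
  rw [lintegral_map hg hΦ, lintegral_withDensity_eq_lintegral_mul _ hφm
      (g := fun z : T2 => g (E z.1, z.2 + c z.1)) (hg.comp hΦ),
    lintegral_withDensity_eq_lintegral_mul _ hMm hg,
    lintegral_torus (hφm.mul (hg.comp hΦ) : Measurable
      ((fun z : T2 => ENNReal.ofReal (φ z.1)) * fun z : T2 => g (E z.1, z.2 + c z.1))),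
    lintegral_torus (hMm.mul hg)]
  simp only [Pi.mul_apply]
  have e1 : ∀ x : S1, ∫⁻ s : S1, ENNReal.ofReal (φ x) * g (E x, s + c x) =
      ENNReal.ofReal (φ x) * Γ (E x) := fun x => by
    rw [lintegral_const_mul' _ _ ENNReal.ofReal_ne_top,
      lintegral_add_right_eq_self (fun s : S1 => g (E x, s)) (c x)]
  have e2 : ∀ x : S1, ∫⁻ s : S1, ENNReal.ofReal (transferOp E φ x) * g (x, s) =
      ENNReal.ofReal (transferOp E φ x) * Γ x := fun x => by
    rw [lintegral_const_mul' _ _ ENNReal.ofReal_ne_top]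
  simp only [e1, e2]
  have e3 := lintegral_withDensity_eq_lintegral_mul (volume : Measure S1)
    hc.measurable.ennreal_ofReal (hΓ.comp hEm)
  have e4 := lintegral_withDensity_eq_lintegral_mul (volume : Measure S1)
    (h.continuous_transferOp hc).measurable.ennreal_ofReal hΓ
  simp only [Pi.mul_apply, Function.comp_apply] at e3 e4
  rw [← e3, ← e4, ← h.map_withDensity hc h0, lintegral_map hΓ hEm]

section

variable {Ω : Type*} [MeasurableSpace Ω] {l : ℝ} {θ : Ω ≃ᵐ Ω} {E : Ω → S1 → S1}
  {P : Measure Ω} {f : Ω → SmoothTorusMap}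

theorem IsSkewProductMap.exists_rotation {k : ℕ} {g : SmoothTorusMap} (h : IsSkewProductMap k g) :
    ∃ c : S1 → S1, Measurable c ∧ ∀ z : T2, g z = (baseMap g z.1, z.2 + c z.1) := by
  obtain ⟨u, τ, -, hτ, hg⟩ := h
  have hc : Continuous ((↑) : ℝ → S1) := AddCircle.continuous_mk' 1
  have hτc := hτ.continuous
  refine ⟨fun x => ((τ x / (2 * Real.pi) : ℝ) : S1), ?_, fun z => ?_⟩
  · exact (hc.comp (by fun_prop)).measurable
  · have := hg z.1 z.2
    rw [Prod.mk.eta] at this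
    rw [this, baseMap, hg]

/-- Continuity in `z` and measurability in `ω` give joint measurability. -/
theorem measurable_family (hmeas : ∀ z : T2, Measurable fun ω => f ω z) :
    Measurable fun q : Ω × T2 => f q.1 q.2 := by
  have := measurable_uncurry_of_continuous_of_measurable (u := fun (z : T2) (ω : Ω) => f ω z)
    (fun ω => (f ω).continuous) hmeas
  exact this.comp measurable_swap

theorem IsRandomExpanding.isEquivariantDensity (h : IsRandomExpanding l E) (hl : 1 < l)
    (hθ : MeasurePreserving θ P P) (hE : ∀ᵐ ω ∂P, E ω = baseMap (f ω)) :
    IsEquivariantDensity P θ f (equivariantDensity θ E) where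
  measurable := h.measurable_equivariantDensity hl
  smooth := Eventually.of_forall (h.smooth hl)
  pos := Eventually.of_forall (h.pos hl)
  integral_eq_one := Eventually.of_forall (h.integral_eq_one hl)
  equivariant := by
    have hall : ∀ᵐ ω ∂P, ∀ n : ℕ, E (θ^[n] ω) = baseMap (f (θ^[n] ω)) :=
      ae_all_iff.2 fun n => (hθ.iterate n).quasiMeasurePreserving.ae hE
    filter_upwards [hall] with ω hω n _
    have hcoc : ∀ n : ℕ, cocycle θ (fun ω' => baseMap (f ω')) n ω = cocycle θ E n ω := by
      intro n
      induction n with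
      | zero => rfl
      | succ n ih => rw [cocycle, cocycle, ih, hω]
    rw [reducedTransferOp, hcoc, (h.transferOp_cocycle hl ω n).2]

theorem IsRandomExpanding.ae_eq_of_isEquivariantDensity [IsProbabilityMeasure P]
    (h : IsRandomExpanding l E) (hl : 1 < l) (hθ : MeasurePreserving θ P P)
    (hE : ∀ᵐ ω ∂P, E ω = baseMap (f ω)) {u : Ω → S1 → ℝ}
    (hu : IsEquivariantDensity P θ f u) : ∀ᵐ ω ∂P, u ω = equivariantDensity θ E ω := by
  refine h.ae_eq_equivariantDensity hl hθ hu.measurable hu.smooth hu.pos hu.integral_eq_one ?_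
  filter_upwards [hE, hu.equivariant] with ω h1 h2
  rw [h1]
  exact h2 1 le_rfl

/-- The measure is assembled from its disintegration as `P ⊗ₘ κ`, and invariance is checked
fibrewise: `f ω` carries `κ ω` to `κ (θ ω)`. Almost sure uniqueness of disintegrations identifies
`condKernel` with `κ`. -/
theorem IsRandomExpanding.exists_invariantMeasure [IsProbabilityMeasure P]
    (h : IsRandomExpanding l E) (hl : 1 < l)
    (hθ : MeasurePreserving θ P P) (hmeas : ∀ z : T2, Measurable fun ω => f ω z) {k : ℕ}
    (hform : ∀ᵐ ω ∂P, IsSkewProductMap k (f ω)) (hE : ∀ᵐ ω ∂P, E ω = baseMap (f ω)) :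
    ∃ (μ : Measure (Ω × T2)) (_ : IsProbabilityMeasure μ), IsInvariantMeasure P θ f μ ∧
      ∀ᵐ ω ∂P,
        μ.condKernel ω = (volume : Measure T2).withDensity
          (fun z => ENNReal.ofReal (equivariantDensity θ E ω z.1)) ∧
        μ.condKernel ω ≪ volume ∧ volume ≪ μ.condKernel ω := by
  set d := equivariantDensity θ E with hd
  have hdm : Measurable (Function.uncurry fun (ω : Ω) (z : T2) => ENNReal.ofReal (d ω z.1)) :=
    ((h.measurable_equivariantDensity hl).comp
      (measurable_fst.prodMk (measurable_fst.comp measurable_snd))).ennreal_ofReal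
  let κ : Kernel Ω T2 := Kernel.withDensity (Kernel.const Ω (volume : Measure T2))
    fun ω z => ENNReal.ofReal (d ω z.1)
  have hκ : ∀ ω, κ ω = (volume : Measure T2).withDensity fun z => ENNReal.ofReal (d ω z.1) :=
    fun ω => by rw [Kernel.withDensity_apply _ hdm, Kernel.const_apply]
  have hdc : ∀ ω, Continuous (d ω) := fun ω => (h.smooth hl ω).continuous
  have hd0 : ∀ ω x, 0 ≤ d ω x := fun ω x => (h.pos hl ω x).le
  have hdz : ∀ ω, Measurable fun z : T2 => ENNReal.ofReal (d ω z.1) := fun ω =>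
    ((hdc ω).measurable.comp measurable_fst).ennreal_ofReal
  have : IsMarkovKernel κ := ⟨fun ω => ⟨by
    rw [hκ, withDensity_apply _ MeasurableSet.univ, Measure.restrict_univ,
      lintegral_torus (hdz ω)]
    simp only [lintegral_const, measure_univ, mul_one]
    exact lintegral_ofReal_eq_one (hdc ω) (hd0 ω) (h.integral_eq_one hl ω)⟩⟩
  have hfst : (P ⊗ₘ κ).fst = P := Measure.fst_compProd P κ
  have hfm := measurable_family hmeas
  refine ⟨P ⊗ₘ κ, inferInstance, ⟨⟨?_, ?_⟩, hfst⟩, ?_⟩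
  · exact (θ.measurable.comp measurable_fst).prodMk hfm
  · have hΘ : Measurable (skewProduct θ f) := (θ.measurable.comp measurable_fst).prodMk hfm
    ext A hA
    rw [Measure.map_apply hΘ hA, Measure.compProd_apply (hΘ hA), Measure.compProd_apply hA,
      -- Shifting the right-hand integral by `θ` lets the integrands be compared at the same `ω`.
      ← hθ.lintegral_comp (Kernel.measurable_kernel_prodMk_left hA)]
    refine lintegral_congr_ae ?_
    filter_upwards [hform, hE] with ω h1 h2
    obtain ⟨c, hcm, hc⟩ := h1.exists_rotation
    obtain ⟨F, hF⟩ := h.exists_lift ω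
    have hmap := hF.map_skew_withDensity hcm (hdc ω) (hd0 ω)
    rw [h.transferOp_equivariantDensity hl, h2,
      show (fun z : T2 => (baseMap (f ω) z.1, z.2 + c z.1)) = f ω from (funext hc).symm] at hmap
    rw [hκ, hκ, ← hmap, Measure.map_apply (f ω).continuous.measurable (measurable_prodMk_left hA)]
    rfl
  · have hcond := eq_condKernel_of_measure_eq_compProd (ρ := P ⊗ₘ κ) κ (by rw [hfst])
    rw [hfst] at hcond
    filter_upwards [hcond] with ω hω
    rw [← hω, hκ]
    exact ⟨rfl, withDensity_absolutelyContinuous _ _, withDensity_absolutelyContinuous'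
      (hdz ω).aemeasurable (Eventually.of_forall fun z =>
        (ENNReal.ofReal_pos.2 (h.pos hl ω z.1)).ne')⟩

/-- A random torus map with almost surely uniformly expanding base maps agrees almost surely with
a family that is uniformly expanding everywhere. -/
theorem exists_isRandomExpanding {f₀ : SmoothTorusMap} (hl : 1 < l)
    (h₀ : ∀ x, l ≤ circleDeriv (baseMap f₀) x) (hmeas : ∀ z : T2, Measurable fun ω => f ω z)
    (hexp : ∀ᵐ ω ∂P, ∀ x, l ≤ circleDeriv (baseMap (f ω)) x)
    (hbdd : ∀ j, ∃ C, ∀ᵐ ω ∂P, distC j (f ω) f₀ ≤ C) :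
    ∃ E : Ω → S1 → S1, IsRandomExpanding l E ∧ ∀ᵐ ω ∂P, E ω = baseMap (f ω) := by
  choose C hC using hbdd
  have hC0 : ∀ j, distC j f₀ f₀ ≤ |C j| := fun j => by simp [distC]
  have hgood : ∀ᵐ ω ∂P, (∀ x, l ≤ circleDeriv (baseMap (f ω)) x) ∧ ∀ j, distC j (f ω) f₀ ≤ C j :=
    hexp.and (ae_all_iff.2 hC)
  -- Outside a measurable set of full measure the base map is replaced by that of `f₀`, so that
  -- every bound holds for all `ω`.
  obtain ⟨S, hSsub, hSm, hS⟩ := hgood.exists_measurable_mem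
  classical
  refine ⟨fun ω => if ω ∈ S then baseMap (f ω) else baseMap f₀, ⟨?_, fun N => ?_⟩, ?_⟩
  · have h1 : Measurable fun q : Ω × S1 => baseMap (f q.1) q.2 :=
      measurable_fst.comp ((measurable_family hmeas).comp
        (measurable_fst.prodMk (measurable_snd.prodMk measurable_const)))
    have h2 : Measurable fun q : Ω × S1 => baseMap f₀ q.2 :=
      measurable_fst.comp (f₀.continuous.measurable.comp (measurable_snd.prodMk measurable_const))
    have h3 : Measurable fun q : Ω × S1 =>
        if q.1 ∈ S then baseMap (f q.1) q.2 else baseMap f₀ q.2 :=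
      Measurable.ite (measurable_fst hSm) h1 h2
    have h4 : ∀ q : Ω × S1, (if q.1 ∈ S then baseMap (f q.1) else baseMap f₀) q.2 =
        if q.1 ∈ S then baseMap (f q.1) q.2 else baseMap f₀ q.2 := fun q => by split_ifs <;> rfl
    simpa only [h4] using h3
  · obtain ⟨B, hB⟩ := f₀.exists_expClass (fun x => hl.le.trans (h₀ x)) N (|C (N + 1)|)
    refine ⟨B, fun ω => ?_⟩
    split_ifs with hω
    · exact hB _ l hl.le (hS ω hω).1 (((hS ω hω).2 _).trans (le_abs_self _))
    · exact hB _ l hl.le h₀ (hC0 _)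
  · filter_upwards [hSsub] with ω hω
    rw [if_pos hω]

theorem ae_past (hθ : MeasurePreserving θ P P) {p : Ω → Prop} (hp : ∀ᵐ ω ∂P, p ω) :
    ∀ᵐ ω ∂P, ∀ j : ℕ, p (θ.symm^[j + 1] ω) :=
  ae_all_iff.2 fun j => ((hθ.symm θ).iterate (j + 1)).quasiMeasurePreserving.ae hp

end

/-- The limit densities depend continuously, in every Sobolev space, on the random maps. -/
theorem exists_sobolevNorm_pullbackDensity_sub_le {f₀ : SmoothTorusMap} {l : ℝ} (hl : 1 < l)
    (h₀ : ∀ x, l ≤ circleDeriv (baseMap f₀) x) (m : ℕ) {η : ℝ≥0∞} (hη : 0 < η) :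
    ∃ δ > 0, ∃ j, ∀ g : ℕ → SmoothTorusMap, (∀ i x, l ≤ circleDeriv (baseMap (g i)) x) →
      ExpSeq l (fun i => baseMap (g i)) → (∀ i, distC j (g i) f₀ ≤ δ) →
        sobolevNorm m (fun x => pullbackDensity (fun i => baseMap (g i)) x -
          pullbackDensity (fun _ => baseMap f₀) x) ≤ η := by
  have h1 : ∀ x, 1 ≤ circleDeriv (baseMap f₀) x := fun x => hl.le.trans (h₀ x)
  have hself : ∀ j, distC j f₀ f₀ ≤ 1 := fun j => by simp [distC]
  have hseq : ExpSeq l fun _ => baseMap f₀ := fun N =>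
    let ⟨B, hB⟩ := f₀.exists_expClass h1 N 1
    ⟨B, fun _ => hB f₀ l hl.le h₀ (hself _)⟩
  obtain ⟨B, hB⟩ := f₀.exists_expClass h1 (2 * (m + 1) + 1) 1
  have hB₀ := hB f₀ l hl.le h₀ (hself _)
  obtain ⟨K, hK⟩ := exists_abs_circleD_pullbackDensity_le 0 hl B
  obtain ⟨K', hK'⟩ := exists_abs_circleD_pullbackDensity_le (2 * (m + 1)) hl B
  obtain ⟨A, hA⟩ := exists_sobolevNorm_le m (2 * max K K')
  have hlim : Tendsto (fun t : ℝ => ENNReal.ofReal (|A| * t) ^ (1 / 2 : ℝ)) (𝓝[>] 0) (𝓝 0) := by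
    have hc : Continuous fun t : ℝ => ENNReal.ofReal (|A| * t) ^ (1 / 2 : ℝ) :=
      ENNReal.continuous_rpow_const.comp (ENNReal.continuous_ofReal.comp (by fun_prop))
    have := (hc.tendsto 0).mono_left (nhdsWithin_le_nhds (s := Set.Ioi 0))
    simpa using this
  -- `t` is the `L¹` closeness for which the interpolated Sobolev bound falls below `η`.
  obtain ⟨t, htη, ht⟩ := ((hlim.eventually (gt_mem_nhds hη)).and self_mem_nhdsWithin).exists
  obtain ⟨δ, hδ, hdist⟩ := exists_integral_abs_pullbackDensity_sub_le hl B hseq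
    (hB₀.mono (by omega)) (η := t) ht
  -- The bound `1` keeps the maps in the expanding class, the bound `δ` gives `L¹` closeness.
  -- Density derivatives of order `r = 2 (m + 1)` require the class of order `r + 1`, which requires
  -- `C^{r + 2}` control of the maps.
  refine ⟨min δ 1, by positivity, 2 * (m + 1) + 1 + 1, fun g hg hgs hd => ?_⟩
  have hgB : ∀ i, ExpClass (2 * (m + 1) + 1) l B (baseMap (g i)) := fun i =>
    hB (g i) l hl.le (hg i) ((hd i).trans (min_le_right _ _))
  have hsm := hgs.isSmoothCircleFun_pullbackDensity hl
  have hsm₀ := hseq.isSmoothCircleFun_pullbackDensity hl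
  refine (hA _ (hsm.sub hsm₀) (fun x => ?_) fun x => ?_).trans (le_trans ?_ htη.le)
  · have e1 := hK _ hgs (fun i => (hgB i).mono (by omega)) x
    have e2 := hK _ hseq (fun _ => hB₀.mono (by omega)) x
    simp only [Function.iterate_zero, id] at e1 e2
    refine (abs_sub _ _).trans ?_
    linarith [le_max_left K K']
  · have e1 := hK' _ hgs hgB x
    have e2 := hK' _ hseq (fun _ => hB₀) x
    rw [iterate_circleD_sub hsm hsm₀]
    refine (abs_sub _ _).trans ?_
    linarith [le_max_right K K']
  · have h2 := hdist _ hgs (fun i => (hgB i).mono (by omega)) fun i x =>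
      ((g i).dist_baseMap_le_distC f₀ _ x).trans ((hd i).trans (min_le_left _ _))
    refine ENNReal.rpow_le_rpow (ENNReal.ofReal_le_ofReal ?_) (by norm_num)
    have h3 : 0 ≤ ∫ x, |pullbackDensity (fun i => baseMap (g i)) x -
      pullbackDensity (fun _ => baseMap f₀) x| := integral_nonneg fun x => abs_nonneg _
    exact mul_le_mul (le_abs_self A) h2 h3 (abs_nonneg A)

end RandomExpanding

/-! ### Proof of the main theorem -/

open RandomExpanding in
theorem mainTheorem4 {Ω : Type*} [MeasurableSpace Ω] (P : Measure Ω) [IsProbabilityMeasure P]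
    (θ : Ω ≃ᵐ Ω) (hθ : Ergodic θ P)
    (k : ℕ) (hk : 2 ≤ k)
    -- the unperturbed partially expanding map
    (f₀ : SmoothTorusMap) (hf₀ : IsSkewProductMap k f₀)
    (hexp : ∀ x, 1 < circleDeriv (baseMap f₀) x)
    -- the random perturbation; noise level `0` is the unperturbed map
    (f : ℝ → Ω → SmoothTorusMap) (hzero : ∀ ω, f 0 ω = f₀)
    (hmeas : ∀ ε > 0, ∀ z : T2, Measurable (fun ω => f ε ω z))
    (hform : ∀ ε > 0, ∀ᵐ ω ∂P, IsSkewProductMap k (f ε ω))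
    (hconv : Tendsto (fun ε => essSup (fun ω => ENNReal.ofReal (distCinf (f ε ω) f₀)) P)
      (𝓝[>] 0) (𝓝 0)) :
    (∃ ε₀ > 0, ∀ ε, 0 ≤ ε → ε < ε₀ → UniformlyExpanding P f₀ (f ε)) ∧
    ∀ ε₀ > 0, (∀ ε, 0 ≤ ε → ε < ε₀ → UniformlyExpanding P f₀ (f ε)) →
      (∀ ε, 0 < ε → ε < ε₀ →
        ∀ j : ℕ, essSup (fun ω => ENNReal.ofReal (distC j (f ε ω) f₀)) P < ∞) →
      ∃ h : ℝ → Ω → S1 → ℝ,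
        (∀ ε, 0 ≤ ε → ε < ε₀ →
          IsEquivariantDensity P θ (f ε) (h ε) ∧
          (∀ h' : Ω → S1 → ℝ, IsEquivariantDensity P θ (f ε) h' → ∀ᵐ ω ∂P, h' ω = h ε ω) ∧
          ∃ (μ : Measure (Ω × T2)) (_ : IsProbabilityMeasure μ),
            IsInvariantMeasure P θ (f ε) μ ∧
            ∀ᵐ ω ∂P,
              μ.condKernel ω =
                (volume : Measure T2).withDensity (fun z => ENNReal.ofReal (h ε ω z.1)) ∧
              μ.condKernel ω ≪ volume ∧ volume ≪ μ.condKernel ω) ∧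
        ∃ h₀ : S1 → ℝ, (∀ᵐ ω ∂P, h 0 ω = h₀) ∧
          ∀ m : ℕ, Tendsto (fun ε => essSup (fun ω => sobolevNorm m (fun x => h ε ω x - h₀ x)) P)
            (𝓝[>] 0) (𝓝 0) := by
  classical
  set l : ℝ := ((⨅ y, circleDeriv (baseMap f₀) y) + 1) / 2 with hl_def
  have hinf := f₀.one_lt_iInf_circleDeriv hexp
  have hinf_le := f₀.iInf_circleDeriv_le hexp
  have hl : 1 < l := by linarith
  have hl₀ : ∀ x, l ≤ circleDeriv (baseMap f₀) x := fun x => by linarith [hinf_le x]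
  have hunif₀ : UniformlyExpanding P f₀ (f 0) := Eventually.of_forall fun ω => by
    rw [hzero]; exact hl₀
  refine ⟨?_, fun ε₀ hε₀ hunif hbdd => ?_⟩
  -- With `λ₀ = 2 l - 1`, a `C¹` error of at most `l - 1` leaves a derivative of at least `λ₀ - (l -
  -- 1) = l`.
  · obtain ⟨ε₀, hε₀, hsub⟩ := mem_nhdsGT_iff_exists_Ioo_subset.1
      (eventually_ae_distC_le hconv 1 (η := l - 1) (by linarith))
    refine ⟨ε₀, hε₀, fun ε h0 h1 => ?_⟩
    rcases h0.eq_or_lt with rfl | h0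
    · exact hunif₀
    · filter_upwards [hsub ⟨h0, h1⟩] with ω hω x
      have h2 := (abs_le.1 ((f ε ω).abs_iterate_circleD_circleDeriv_sub_le f₀ (j := 0) le_rfl x)).1
      simp only [Function.iterate_zero, id] at h2
      linarith [hinf_le x]
  · have hθm : MeasurePreserving θ P P := hθ.toMeasurePreserving
    have hmeas' : ∀ ε, 0 ≤ ε → ∀ z : T2, Measurable fun ω => f ε ω z := fun ε h0 => by
      rcases h0.eq_or_lt with rfl | h0
      · simp only [hzero]; exact fun z => measurable_const
      · exact hmeas ε h0
    have hform' : ∀ ε, 0 ≤ ε → ∀ᵐ ω ∂P, IsSkewProductMap k (f ε ω) := fun ε h0 => by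
      rcases h0.eq_or_lt with rfl | h0
      · exact Eventually.of_forall fun ω => by rw [hzero]; exact hf₀
      · exact hform ε h0
    have hbdd' : ∀ ε, 0 ≤ ε → ε < ε₀ → ∀ j, ∃ C, ∀ᵐ ω ∂P, distC j (f ε ω) f₀ ≤ C := by
      intro ε h0 h1 j
      rcases h0.eq_or_lt with rfl | h0
      · exact ⟨0, Eventually.of_forall fun ω => by rw [hzero]; simp [distC]⟩
      · refine ⟨(essSup (fun ω => ENNReal.ofReal (distC j (f ε ω) f₀)) P).toReal, ?_⟩
        filter_upwards [ENNReal.ae_le_essSup fun ω => ENNReal.ofReal (distC j (f ε ω) f₀)]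
          with ω hω
        exact (ENNReal.ofReal_le_iff_le_toReal (hbdd ε h0 h1 j).ne).1 hω
    -- The family is totalized in `ε`, with a junk value outside `[0, ε₀)`, so that it can be chosen
    -- for all `ε` at once.
    have hex : ∀ ε, ∃ E : Ω → S1 → S1, 0 ≤ ε → ε < ε₀ →
        IsRandomExpanding l E ∧ ∀ᵐ ω ∂P, E ω = baseMap (f ε ω) := fun ε => by
      by_cases h : 0 ≤ ε ∧ ε < ε₀
      · obtain ⟨E, hE⟩ := exists_isRandomExpanding hl hl₀ (hmeas' ε h.1) (hunif ε h.1 h.2)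
          (hbdd' ε h.1 h.2)
        exact ⟨E, fun _ _ => hE⟩
      · exact ⟨fun _ _ => 0, fun h0 h1 => absurd ⟨h0, h1⟩ h⟩
    choose E hE using hex
    have hpast : ∀ ε, 0 ≤ ε → ε < ε₀ → ∀ᵐ ω ∂P,
        past θ (E ε) ω = fun j => baseMap (f ε (θ.symm^[j + 1] ω)) := fun ε h0 h1 => by
      filter_upwards [ae_past hθm (hE ε h0 h1).2] with ω hω
      exact funext hω
    refine ⟨fun ε => equivariantDensity θ (E ε), fun ε h0 h1 => ?_,
      pullbackDensity fun _ => baseMap f₀, ?_, fun m => ?_⟩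
    · obtain ⟨hE1, hE2⟩ := hE ε h0 h1
      exact ⟨hE1.isEquivariantDensity hl hθm hE2,
        fun h' hh' => hE1.ae_eq_of_isEquivariantDensity hl hθm hE2 hh',
        hE1.exists_invariantMeasure hl hθm (hmeas' ε h0) (hform' ε h0) hE2⟩
    · filter_upwards [hpast 0 le_rfl hε₀] with ω hω
      simp only [equivariantDensity, hω, hzero]
    · rw [ENNReal.tendsto_nhds_zero]
      intro η hη
      obtain ⟨δ, hδ, j, hsob⟩ := exists_sobolevNorm_pullbackDensity_sub_le hl hl₀ m hη
      -- The threshold `δ` does not depend on `ω`, and `ae_past` transfers each almost sure bound to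
      -- all past times at once; this gives the essential supremum.
      filter_upwards [eventually_ae_distC_le hconv j hδ, Ioo_mem_nhdsGT hε₀] with ε hd hε
      refine essSup_le_of_ae_le η ?_
      filter_upwards [hpast ε hε.1.le hε.2, ae_past hθm hd, ae_past hθm (hunif ε hε.1.le hε.2)]
        with ω h1 h2 h3
      have hseq := (hE ε hε.1.le hε.2).1.expSeq θ ω
      rw [h1] at hseq
      simp only [equivariantDensity, h1]
      exact hsob _ h3 hseq h2
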